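/- Write $(t,x)\in\mathbb R_+\times\mathbb R^3$, $r=|x|$, $\partial=(\partial_t,\nabla)$, $\Box=\partial_t^2-\Delta$, $\Omega=x\times\nabla$, $S=t\partial_t+r\partial_r$, and let $Z$ range over the components of $(\partial_t,\nabla,\Omega,S)$. Put $|\partial Z^{\le N}w|=\sum_{|\mu|\le N}|\partial Z^\mu w|$ and $|\Box Z^{\le N}w|=\sum_{|\mu|\le N}|\Box Z^\mu w|$, the sums running over all products $Z^\mu$ of at most $N$ of the fields, and let $\|u\|_{L^pL^q(D)}$ be the $L^p$ norm in $t$ of the $L^q(\mathbb R^3)$ norm of $\mathbf 1_Du(t,\cdot)$. Let $$C_\tau=\{\tau\le t\le 2\tau,\ r\le t+2\},\qquad \tilde C_\tau=\{\tfrac78\tau\le t\le\tfrac{17}8\tau,\ r\le t+2\},$$ and define the regions and their enlargements as follows. * $C^1_\tau=C_\tau\cap\{r\le2\}$ and $\tilde C^1_\tau=\tilde C_\tau\cap\{r\le\frac{17}8\}$ (the case $R=1$); $C^R_\tau=C_\tau\cap\{R\le r\le2R\}$ and $\tilde C^R_\tau=\tilde C_\tau\cap\{\frac78R\le r\le\frac{17}8R\}$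 for $1<R\le\tau/4$. * $C^{\tau/2}_\tau=C_\tau\cap\{t-r\ge\frac\tau2,\ r\ge\frac\tau2\}$ and $\tilde C^{\tau/2}_\tau=\tilde C_\tau\cap\{t-r\ge\frac78\cdot\frac\tau2,\ r\ge\frac78\cdot\frac\tau2\}$ (the case $R=\tau/2$). * $C^{U=1}_\tau=C_\tau\cap\{|t-r|\le2\}$ and $\tilde C^{U=1}_\tau=\tilde C_\tau\cap\{|t-r|\le\frac{17}8\}$; $C^U_\tau=C_\tau\cap\{U\le t-r\le2U\}$ and $\tilde C^U_\tau=\tilde C_\tau\cap\{\frac78U\le t-r\le\frac{17}8U\}$ for $1<U\le\tau/4$. Then there is an absolute constant $K$ such that for every real-valued $w\in C^\infty((0,\infty)\times\mathbb R^3)$ the following hold. For all $\tau\ge1$ and $1\le R\le\tau/2$ with $R=1$, $R\le\tau/4$ or $R=\tau/2$ (in particular for all dyadic $\tau$ and $R$ with $1\le R\le\tau/2$), $$\|\partial w\|_{L^\infty L^\infty(C^R_\tau)}\le K\Bigl(\tau^{-1/2}R^{-3/2}\|\partial Z^{\le3}w\|_{L^2L^2(\tilde C^R_\tau)}+\tau^{-1/2}R^{-1/2}\|\Box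 Z^{\le2}w\|_{L^2L^2(\tilde C^R_\tau)}\Bigr).$$ When $\tau=2$ and $R=1=\tau/2$, this holds for both of the regions $C^1_\tau$ (the ball $r\le 2$) and $C^{\tau/2}_\tau$, each with its own enlargement. For all $\tau\ge1$ and $1\le U\le\tau/4$, $$\|\partial w\|_{L^\infty L^\infty(C^U_\tau)}\le K\Bigl(U^{-1/2}\tau^{-3/2}\|\partial Z^{\le3}w\|_{L^2L^2(\tilde C^U_\tau)}+U^{-1/2}\tau^{-1/2}\|\Box Z^{\le2}w\|_{L^2L^2(\tilde C^U_\tau)}\Bigr).$$ -/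

import Mathlib

open MeasureTheory Set
open scoped ENNReal NNReal ContDiff

noncomputable section

namespace WaveDecay

/-- Points `(t, x)` of space-time `ℝ × ℝ³`. -/
abbrev SpaceTime : Type := ℝ × EuclideanSpace ℝ (Fin 3)

/-- The time derivative `∂ₜ w`. -/
def dt (w : SpaceTime → ℝ) : SpaceTime → ℝ :=
  fun p => fderiv ℝ w p (1, 0)

/-- The spatial partial derivative `∂ᵢ w`. -/
def dx (i : Fin 3) (w : SpaceTime → ℝ) : SpaceTime → ℝ :=
  fun p => fderiv ℝ w p (0, EuclideanSpace.single i 1)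

/-- The components of `Ω = x × ∇`; indices are taken modulo 3. -/
def rot (i : Fin 3) (w : SpaceTime → ℝ) : SpaceTime → ℝ :=
  fun p => p.2 (i + 1) * dx (i + 2) w p - p.2 (i + 2) * dx (i + 1) w p

/-- The scaling field `S = t ∂ₜ + r ∂ᵣ`, where `r ∂ᵣ = x · ∇`. -/
def scal (w : SpaceTime → ℝ) : SpaceTime → ℝ :=
  fun p => p.1 * dt w p + ∑ i, p.2 i * dx i w p

/-- The eight admissible vector fields `Z = (∂ₜ, ∇, Ω, S)`. -/
def adm : Fin 8 → (SpaceTime → ℝ) → (SpaceTime → ℝ) :=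
  ![dt, dx 0, dx 1, dx 2, rot 0, rot 1, rot 2, scal]

/-- `Z^μ w = Z_{μ₀} Z_{μ₁} ⋯ Z_{μ_{k-1}} w` for a word `μ` of length `k`. -/
def admWord {k : ℕ} (μ : Fin k → Fin 8) (w : SpaceTime → ℝ) : SpaceTime → ℝ :=
  (List.ofFn μ).foldr adm w

/-- The d'Alembertian `□ = ∂ₜ² - Δ`. -/
def box (w : SpaceTime → ℝ) : SpaceTime → ℝ :=
  fun p => dt (dt w) p - ∑ i, dx i (dx i w) p

/-- The length `|∂w|` of the space-time gradient `∂w = (∂ₜ w, ∇ w)`. -/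
def gradAbs (w : SpaceTime → ℝ) : SpaceTime → ℝ :=
  fun p => Real.sqrt (dt w p ^ 2 + ∑ i, dx i w p ^ 2)

/-- `|∂ Z^{≤ N} w|`, the sum of `|∂ Z^μ w|` over all words `μ` of length at most `N`. -/
def gradZ (N : ℕ) (w : SpaceTime → ℝ) : SpaceTime → ℝ :=
  fun p => ∑ k ∈ Finset.range (N + 1), ∑ μ : Fin k → Fin 8, gradAbs (admWord μ w) p

/-- `|□ Z^{≤ N} w|`, the sum of `|□ Z^μ w|` over all words `μ` of length at most `N`. -/
def boxZ (N : ℕ) (w : SpaceTime → ℝ) : SpaceTime → ℝ :=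
  fun p => ∑ k ∈ Finset.range (N + 1), ∑ μ : Fin k → Fin 8, |box (admWord μ w) p|

/-- The mixed norm `‖u‖_{L^p L^q(D)}` of a function on a set `D` of space-time: the
`L^p` norm over `t ≥ 0` of the `L^q(ℝ³)` norm of `1_D(t, ·) u(t, ·)`. -/
def mixedNorm (p q : ℝ≥0∞) (D : Set SpaceTime) (u : SpaceTime → ℝ) : ℝ≥0∞ :=
  eLpNorm (fun t : ℝ =>
    eLpNorm (fun x : EuclideanSpace ℝ (Fin 3) => D.indicator u (t, x)) q volume)
    p (volume.restrict (Ici 0))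

/-- `C = {r ≤ t + 2}` in `ℝ₊ × ℝ³`. -/
def cone : Set SpaceTime := {p | 0 ≤ p.1 ∧ ‖p.2‖ ≤ p.1 + 2}

/-- The part of `C` with `τ ≤ t ≤ 2τ`. -/
def strip (τ : ℝ) : Set SpaceTime := cone ∩ {p | τ ≤ p.1 ∧ p.1 ≤ 2 * τ}

/-- The part of `C` with `(7/8)τ ≤ t ≤ (17/8)τ`. -/
def stripE (τ : ℝ) : Set SpaceTime :=
  cone ∩ {p | 7 / 8 * τ ≤ p.1 ∧ p.1 ≤ 17 / 8 * τ}

open Classical in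
/-- `C^R_τ`, for `R = 1` or `1 < R ≤ τ/4`. -/
def regR (τ R : ℝ) : Set SpaceTime :=
  if R = 1 then strip τ ∩ {p | ‖p.2‖ ≤ 2}
  else strip τ ∩ {p | R ≤ ‖p.2‖ ∧ ‖p.2‖ ≤ 2 * R}

open Classical in
/-- The enlargement of `C^R_τ`. -/
def regRE (τ R : ℝ) : Set SpaceTime :=
  if R = 1 then stripE τ ∩ {p | ‖p.2‖ ≤ 17 / 8}
  else stripE τ ∩ {p | 7 / 8 * R ≤ ‖p.2‖ ∧ ‖p.2‖ ≤ 17 / 8 * R}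

/-- `C^{τ/2}_τ`, the region left over between the `R`- and the `U`-regions. -/
def regHalf (τ : ℝ) : Set SpaceTime :=
  strip τ ∩ {p | τ / 2 ≤ p.1 - ‖p.2‖ ∧ τ / 2 ≤ ‖p.2‖}

/-- The enlargement of `C^{τ/2}_τ`. -/
def regHalfE (τ : ℝ) : Set SpaceTime :=
  stripE τ ∩ {p | 7 / 8 * (τ / 2) ≤ p.1 - ‖p.2‖ ∧ 7 / 8 * (τ / 2) ≤ ‖p.2‖}

open Classical in
/-- `C^U_τ`, for `1 ≤ U ≤ τ/4`. -/
def regU (τ U : ℝ) : Set SpaceTime :=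
  if U = 1 then strip τ ∩ {p | |p.1 - ‖p.2‖| ≤ 2}
  else strip τ ∩ {p | U ≤ p.1 - ‖p.2‖ ∧ p.1 - ‖p.2‖ ≤ 2 * U}

open Classical in
/-- The enlargement of `C^U_τ`. -/
def regUE (τ U : ℝ) : Set SpaceTime :=
  if U = 1 then stripE τ ∩ {p | |p.1 - ‖p.2‖| ≤ 17 / 8}
  else stripE τ ∩ {p | 7 / 8 * U ≤ p.1 - ‖p.2‖ ∧ p.1 - ‖p.2‖ ≤ 17 / 8 * U}

end WaveDecay

end

noncomputable section

namespace WaveDecay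

open scoped RealInnerProductSpace

/-! Space-time has four dimensions, so a plain Sobolev embedding for `∂w` needs more than two
derivatives. The proof splits the dimensions as 3 + 1. Three directions are spanned by admissible
fields: scaling together with two rotations, or, near the axis, scaling together with two
translations. In three dimensions two `L²` derivatives bound the supremum, so two fields are spent.
In the remaining radial direction the fundamental theorem of calculus needs one more derivative,
`∂_r ∂Z^{≤2}w`, on a segment of length `L`.

That derivative is the point of the theorem: `L |∂_r ∂Z^{≤2}w|` is bounded by `|∂Z^{≤3}w| + κ
|□Z^{≤2}w|`. Away from the light cone, `S∂f`, `Ω∂f` and `□f` determine the Hessian of `f`, with a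
loss governed by `t² - r²` (`Smooth.hessBound_of_timelike`). Where `L ≤ 1` the fields `∇` themselves
suffice (`Smooth.hessBound_of_le_one`).

The powers in the estimate are the volume of a cell: time length `τ`, spherical area `κ²`, radial
length `L`, giving the factor `(τ κ² L)^{-1/2}`. Up to constants, `(κ, L)` is `(R, R)` on the
`R`-regions and `(τ, U)` on the `U`-regions; the `□` term carries one further factor `κ`.

The three-dimensional embedding is a Taylor formula along curves generated by the fields
(`abs_le_integral_of_hasDerivAt`), averaged over the directions of the curves (`average_le`). The
radial step is `Smooth.energy_le_segment`. They are combined in `Smooth.sq_dirD_le_of_ball` and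
`Smooth.sq_dirD_le_of_shell`. -/

abbrev E3 : Type := EuclideanSpace ℝ (Fin 3)

/-! ### Admissible fields as vector-valued maps, and their commutators -/

/-- The open half space `{t > 0}`. -/
def future : Set SpaceTime := {p | 0 < p.1}

theorem isOpen_future : IsOpen future := isOpen_lt continuous_const continuous_fst

/-- Smoothness on the open half space. -/
def Smooth (f : SpaceTime → ℝ) : Prop := ContDiffOn ℝ ∞ f future

/-- The derivative in a constant direction. -/
def dirD (v : SpaceTime) (f : SpaceTime → ℝ) : SpaceTime → ℝ := fun p => fderiv ℝ f p v

/-- The coefficient fields of the rotations. -/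
def rotFld (i : Fin 3) : SpaceTime → SpaceTime := fun p =>
  (0, p.2 (i + 1) • EuclideanSpace.single (i + 2) 1 - p.2 (i + 2) • EuclideanSpace.single (i + 1) 1)

/-- The admissible fields as vector-valued functions. -/
def fld : Fin 8 → SpaceTime → SpaceTime :=
  ![fun _ => (1, 0), fun _ => (0, EuclideanSpace.single 0 1),
    fun _ => (0, EuclideanSpace.single 1 1), fun _ => (0, EuclideanSpace.single 2 1),
    rotFld 0, rotFld 1, rotFld 2, fun p => p]

theorem eq_sum_single (y : E3) :
    y = ∑ i, y i • (EuclideanSpace.single i 1 : E3) := by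
  ext j
  fin_cases j <;> simp [Fin.sum_univ_three]

theorem clm_apply_eq (F : SpaceTime →L[ℝ] ℝ) (v : SpaceTime) :
    F v = v.1 * F (1, 0) + ∑ i, v.2 i * F (0, EuclideanSpace.single i 1) := by
  have h : v = v.1 • ((1, 0) : SpaceTime) +
      ∑ i, v.2 i • ((0, EuclideanSpace.single i 1) : SpaceTime) := by
    refine Prod.ext ?_ ?_
    · simp [Prod.fst_sum]
    · simpa [Prod.snd_sum] using eq_sum_single v.2
  conv_lhs => rw [h]
  simp only [map_add, map_sum, map_smul, smul_eq_mul]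

theorem dirD_eq (v : SpaceTime) (f : SpaceTime → ℝ) (p : SpaceTime) :
    dirD v f p = v.1 * dt f p + ∑ i, v.2 i * dx i f p :=
  clm_apply_eq _ v

theorem rot_eq (i : Fin 3) (f : SpaceTime → ℝ) (p : SpaceTime) :
    rot i f p = fderiv ℝ f p (rotFld i p) := by
  rw [clm_apply_eq]
  fin_cases i <;> simp [rot, rotFld, dx, Fin.sum_univ_three] <;> ring

theorem adm_eq (k : Fin 8) (f : SpaceTime → ℝ) (p : SpaceTime) :
    adm k f p = fderiv ℝ f p (fld k p) := by
  fin_cases k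
  · rfl
  · rfl
  · rfl
  · rfl
  · exact rot_eq 0 f p
  · exact rot_eq 1 f p
  · exact rot_eq 2 f p
  · exact (clm_apply_eq _ p).symm

/-- The linear part of a rotation field. -/
def rotLin (i : Fin 3) : SpaceTime →ₗ[ℝ] SpaceTime where
  toFun := rotFld i
  map_add' p q := by
    refine Prod.ext (by simp [rotFld]) ?_
    simp only [rotFld, Prod.snd_add, PiLp.add_apply, add_smul]
    abel
  map_smul' c p := by
    refine Prod.ext (by simp [rotFld]) ?_
    simp [rotFld, mul_smul, smul_sub]

theorem exists_lin (k : Fin 8) :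
    ∃ A : SpaceTime →L[ℝ] SpaceTime, ∀ p, HasFDerivAt (fld k) A p := by
  have hr : ∀ i, ∃ A : SpaceTime →L[ℝ] SpaceTime, ∀ p, HasFDerivAt (rotFld i) A p := fun i =>
    ⟨LinearMap.toContinuousLinearMap (rotLin i),
      fun p => (LinearMap.toContinuousLinearMap (rotLin i)).hasFDerivAt⟩
  fin_cases k
  · exact ⟨0, fun p => hasFDerivAt_const _ _⟩
  · exact ⟨0, fun p => hasFDerivAt_const _ _⟩
  · exact ⟨0, fun p => hasFDerivAt_const _ _⟩
  · exact ⟨0, fun p => hasFDerivAt_const _ _⟩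
  · exact hr 0
  · exact hr 1
  · exact hr 2
  · exact ⟨ContinuousLinearMap.id ℝ _, fun p => hasFDerivAt_id p⟩

/-- The linear part of an admissible field. -/
def lin (k : Fin 8) : SpaceTime →L[ℝ] SpaceTime := (exists_lin k).choose

theorem hasFDerivAt_fld (k : Fin 8) (p : SpaceTime) : HasFDerivAt (fld k) (lin k) p :=
  (exists_lin k).choose_spec p

/-- A common bound for the linear parts of the admissible fields. -/
def linBound : ℝ := 1 + ∑ k, ‖lin k‖

theorem one_le_linBound : 1 ≤ linBound :=
  le_add_of_nonneg_right (Finset.sum_nonneg fun _ _ => norm_nonneg _)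

theorem norm_lin_le (k : Fin 8) (v : SpaceTime) : ‖lin k v‖ ≤ linBound * ‖v‖ := by
  refine (lin k).le_of_opNorm_le ?_ v
  have := Finset.single_le_sum (f := fun k => ‖lin k‖) (fun _ _ => norm_nonneg _)
    (Finset.mem_univ k)
  unfold linBound
  linarith

namespace Smooth

variable {f g : SpaceTime → ℝ}

theorem contDiffAt (hf : Smooth f) {p : SpaceTime} (hp : p ∈ future) : ContDiffAt ℝ ∞ f p :=
  ContDiffOn.contDiffAt hf (isOpen_future.mem_nhds hp)

theorem differentiableAt (hf : Smooth f) {p : SpaceTime} (hp : p ∈ future) :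
    DifferentiableAt ℝ f p := (hf.contDiffAt hp).differentiableAt (by simp)

theorem continuousOn (hf : Smooth f) : ContinuousOn f future := ContDiffOn.continuousOn hf

theorem fderiv (hf : Smooth f) : ContDiffOn ℝ ∞ (fderiv ℝ f) future :=
  ContDiffOn.fderiv_of_isOpen hf isOpen_future (by simp)

theorem fderiv_differentiableAt (hf : Smooth f) {p : SpaceTime} (hp : p ∈ future) :
    DifferentiableAt ℝ (_root_.fderiv ℝ f) p :=
  ((hf.fderiv).contDiffAt (isOpen_future.mem_nhds hp)).differentiableAt (by simp)

theorem dirD (hf : Smooth f) (v : SpaceTime) : Smooth (dirD v f) :=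
  hf.fderiv.clm_apply contDiffOn_const

theorem adm (hf : Smooth f) (k : Fin 8) : Smooth (adm k f) := by
  have hk : ContDiff ℝ ∞ (fld k) := by
    -- Each field is affine: subtracting its constant derivative leaves a map with zero derivative.
    have h : fld k = fun p => lin k p + fld k 0 := by
      have hd : ∀ p, HasFDerivAt (fun p => fld k p - lin k p) (0 : SpaceTime →L[ℝ] SpaceTime) p :=
        fun p => by simpa using (hasFDerivAt_fld k p).fun_sub (lin k).hasFDerivAt
      funext p
      have := is_const_of_fderiv_eq_zero (𝕜 := ℝ) (f := fun p => fld k p - lin k p)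
        (fun p => (hd p).differentiableAt) (fun p => (hd p).fderiv) p 0
      simp only [map_zero, sub_zero] at this
      rw [← this]; abel
    rw [h]
    fun_prop
  have h : WaveDecay.adm k f = fun p => _root_.fderiv ℝ f p (fld k p) := funext (adm_eq k f)
  rw [h]
  exact hf.fderiv.clm_apply hk.contDiffOn

theorem admWord (hf : Smooth f) {k : ℕ} (μ : Fin k → Fin 8) : Smooth (admWord μ f) := by
  unfold WaveDecay.admWord
  induction List.ofFn μ with
  | nil => exact hf
  | cons a l ih => exact ih.adm a

theorem dt (hf : Smooth f) : Smooth (dt f) := hf.dirD _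

theorem dx (hf : Smooth f) (i : Fin 3) : Smooth (dx i f) := hf.dirD _

theorem dirD_comm (hf : Smooth f) (v u : SpaceTime) {p : SpaceTime} (hp : p ∈ future) :
    WaveDecay.dirD u (WaveDecay.dirD v f) p = WaveDecay.dirD v (WaveDecay.dirD u f) p := by
  have h : ∀ u v, WaveDecay.dirD u (WaveDecay.dirD v f) p =
      _root_.fderiv ℝ (_root_.fderiv ℝ f) p u v := by
    intro u v
    have := ((hf.fderiv_differentiableAt hp).hasFDerivAt.clm_apply (hasFDerivAt_const v p)).fderiv
    unfold WaveDecay.dirD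
    rw [this]
    simp
  rw [h, h]
  exact (hf.contDiffAt hp).isSymmSndFDerivAt (by simpa using WithTop.coe_le_coe.2 (le_top (a := (2 : ℕ∞)))) u v

/-- Second derivatives are symmetric, so the commutator comes only from differentiating the
coefficients of the field. These are affine, so it is again a derivative in a constant direction. -/
theorem adm_dirD (hf : Smooth f) (k : Fin 8) (v : SpaceTime) {p : SpaceTime} (hp : p ∈ future) :
    WaveDecay.adm k (WaveDecay.dirD v f) p =
      WaveDecay.dirD v (WaveDecay.adm k f) p - WaveDecay.dirD (lin k v) f p := by
  have h1 : WaveDecay.adm k (WaveDecay.dirD v f) p =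
      _root_.fderiv ℝ (_root_.fderiv ℝ f) p (fld k p) v := by
    have := ((hf.fderiv_differentiableAt hp).hasFDerivAt.clm_apply (hasFDerivAt_const v p)).fderiv
    rw [adm_eq]
    unfold WaveDecay.dirD
    rw [this]
    simp
  have h2 : WaveDecay.dirD v (WaveDecay.adm k f) p =
      _root_.fderiv ℝ (_root_.fderiv ℝ f) p v (fld k p) + _root_.fderiv ℝ f p (lin k v) := by
    have := ((hf.fderiv_differentiableAt hp).hasFDerivAt.clm_apply (hasFDerivAt_fld k p)).fderiv
    have h : WaveDecay.adm k f = fun p => _root_.fderiv ℝ f p (fld k p) := funext (adm_eq k f)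
    rw [h]
    unfold WaveDecay.dirD
    rw [this]
    simp [add_comm]
  rw [h1, h2, (hf.contDiffAt hp).isSymmSndFDerivAt (by simpa using WithTop.coe_le_coe.2 (le_top (a := (2 : ℕ∞)))) (fld k p) v]
  unfold WaveDecay.dirD
  ring

theorem adm_adm_dirD (hf : Smooth f) (j k : Fin 8) (v : SpaceTime) {p : SpaceTime}
    (hp : p ∈ future) :
    WaveDecay.adm j (WaveDecay.adm k (WaveDecay.dirD v f)) p =
      WaveDecay.dirD v (WaveDecay.adm j (WaveDecay.adm k f)) p
        - WaveDecay.dirD (lin j v) (WaveDecay.adm k f) p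
        - WaveDecay.dirD (lin k v) (WaveDecay.adm j f) p
        + WaveDecay.dirD (lin j (lin k v)) f p := by
  have hev : WaveDecay.adm k (WaveDecay.dirD v f) =ᶠ[nhds p]
      (WaveDecay.dirD v (WaveDecay.adm k f) - WaveDecay.dirD (lin k v) f) := by
    filter_upwards [isOpen_future.mem_nhds hp] with q hq
    exact hf.adm_dirD k v hq
  rw [adm_eq, hev.fderiv_eq, fderiv_sub (((hf.adm k).dirD v).differentiableAt hp)
    ((hf.dirD _).differentiableAt hp)]
  simp only [sub_apply]
  rw [← adm_eq, ← adm_eq, (hf.adm k).adm_dirD j v hp, hf.adm_dirD j _ hp]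
  ring

end Smooth

/-! ### Pointwise bounds by words of length at most two -/

/-- The square of `gradAbs`. -/
def gradSq (f : SpaceTime → ℝ) : SpaceTime → ℝ := fun p => dt f p ^ 2 + ∑ i, dx i f p ^ 2

theorem gradSq_nonneg (f : SpaceTime → ℝ) (p : SpaceTime) : 0 ≤ gradSq f p := by
  unfold gradSq; positivity

theorem gradAbs_nonneg (f : SpaceTime → ℝ) (p : SpaceTime) : 0 ≤ gradAbs f p := Real.sqrt_nonneg _

theorem sq_gradAbs (f : SpaceTime → ℝ) (p : SpaceTime) : gradAbs f p ^ 2 = gradSq f p :=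
  Real.sq_sqrt (gradSq_nonneg f p)

theorem abs_dt_le (f : SpaceTime → ℝ) (p : SpaceTime) : |dt f p| ≤ gradAbs f p := by
  refine Real.abs_le_sqrt ?_
  have : 0 ≤ ∑ i, dx i f p ^ 2 := by positivity
  linarith

theorem abs_dx_le (i : Fin 3) (f : SpaceTime → ℝ) (p : SpaceTime) : |dx i f p| ≤ gradAbs f p := by
  refine Real.abs_le_sqrt ?_
  have := Finset.single_le_sum (f := fun i => dx i f p ^ 2) (fun _ _ => sq_nonneg _)
    (Finset.mem_univ i)
  have h2 := sq_nonneg (dt f p)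
  linarith

theorem abs_apply_le_norm (y : E3) (i : Fin 3) : |y i| ≤ ‖y‖ := by
  simpa using PiLp.norm_apply_le y i

theorem abs_dirD_le (v : SpaceTime) (f : SpaceTime → ℝ) (p : SpaceTime) :
    |dirD v f p| ≤ 4 * ‖v‖ * gradAbs f p := by
  rw [dirD_eq, Fin.sum_univ_three]
  have hg := gradAbs_nonneg f p
  have h0 : |v.1 * dt f p| ≤ ‖v‖ * gradAbs f p := by
    rw [abs_mul]
    exact mul_le_mul (norm_fst_le v) (abs_dt_le f p) (abs_nonneg _) (norm_nonneg _)
  have hi : ∀ i, |v.2 i * dx i f p| ≤ ‖v‖ * gradAbs f p := fun i => by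
    rw [abs_mul]
    exact mul_le_mul ((abs_apply_le_norm _ i).trans (norm_snd_le v)) (abs_dx_le i f p)
      (abs_nonneg _) (norm_nonneg _)
  have h1 := hi 0
  have h2 := hi 1
  have h3 := hi 2
  rw [abs_le] at *
  constructor <;> linarith

theorem admWord_zero (μ : Fin 0 → Fin 8) (w : SpaceTime → ℝ) : admWord μ w = w := by
  simp [admWord]

theorem admWord_cons {k : ℕ} (j : Fin 8) (μ : Fin k → Fin 8) (w : SpaceTime → ℝ) :
    admWord (Fin.cons j μ : Fin (k + 1) → Fin 8) w = adm j (admWord μ w) := by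
  simp [admWord, List.ofFn_succ]

theorem gradZ_nonneg (N : ℕ) (w : SpaceTime → ℝ) (p : SpaceTime) : 0 ≤ gradZ N w p :=
  Finset.sum_nonneg fun _ _ => Finset.sum_nonneg fun _ _ => gradAbs_nonneg _ _

theorem le_sum_words (F : (SpaceTime → ℝ) → ℝ) (hF : ∀ f, 0 ≤ F f) (w : SpaceTime → ℝ)
    {k N : ℕ} (hk : k ≤ N) (μ : Fin k → Fin 8) :
    F (admWord μ w) ≤ ∑ k ∈ Finset.range (N + 1), ∑ μ : Fin k → Fin 8, F (admWord μ w) :=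
  (Finset.single_le_sum (f := fun μ : Fin k → Fin 8 => F (admWord μ w)) (fun _ _ => hF _)
    (Finset.mem_univ μ)).trans
  (Finset.single_le_sum (f := fun k => ∑ μ : Fin k → Fin 8, F (admWord μ w))
    (fun _ _ => Finset.sum_nonneg fun _ _ => hF _) (Finset.mem_range.2 (Nat.lt_succ_of_le hk)))

theorem gradAbs_admWord_le (w : SpaceTime → ℝ) (p : SpaceTime) {k N : ℕ} (hk : k ≤ N)
    (μ : Fin k → Fin 8) : gradAbs (admWord μ w) p ≤ gradZ N w p :=
  le_sum_words (fun f => gradAbs f p) (fun f => gradAbs_nonneg f p) w hk μ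

theorem abs_box_admWord_le (w : SpaceTime → ℝ) (p : SpaceTime) {k N : ℕ} (hk : k ≤ N)
    (μ : Fin k → Fin 8) : |box (admWord μ w) p| ≤ boxZ N w p :=
  le_sum_words (fun f => |box f p|) (fun _ => abs_nonneg _) w hk μ

/-- The quadratic energy density `∑ |∂ Z^μ w|²` over words of length at most `2`. -/
def energy (w : SpaceTime → ℝ) : SpaceTime → ℝ :=
  fun p => ∑ k ∈ Finset.range 3, ∑ μ : Fin k → Fin 8, gradSq (admWord μ w) p

theorem energy_nonneg (w : SpaceTime → ℝ) (p : SpaceTime) : 0 ≤ energy w p :=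
  Finset.sum_nonneg fun _ _ => Finset.sum_nonneg fun _ _ => gradSq_nonneg _ _

theorem gradAbs_admWord_le_sqrt (w : SpaceTime → ℝ) (p : SpaceTime) {k : ℕ} (hk : k ≤ 2)
    (μ : Fin k → Fin 8) : gradAbs (admWord μ w) p ≤ Real.sqrt (energy w p) :=
  Real.sqrt_le_sqrt
    (le_sum_words (fun f => gradSq f p) (fun f => gradSq_nonneg f p) w (N := 2) hk μ)

theorem energy_le_sq_gradZ (w : SpaceTime → ℝ) (p : SpaceTime) :
    energy w p ≤ 73 * gradZ 3 w p ^ 2 := by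
  have h : ∀ k ≤ 2, ∑ μ : Fin k → Fin 8, gradSq (admWord μ w) p ≤
      (8 : ℝ) ^ k * gradZ 3 w p ^ 2 := by
    intro k hk
    refine (Finset.sum_le_card_nsmul _ _ (gradZ 3 w p ^ 2) ?_).trans (by simp)
    intro μ _
    rw [← sq_gradAbs]
    exact pow_le_pow_left₀ (gradAbs_nonneg _ _) (gradAbs_admWord_le w p (by omega) μ) 2
  unfold energy
  -- There are 1 + 8 + 64 = 73 words of length at most two.
  rw [Finset.sum_range_succ, Finset.sum_range_succ, Finset.sum_range_one]
  have h0 := h 0 (by norm_num)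
  have h1 := h 1 (by norm_num)
  have h2 := h 2 (by norm_num)
  linarith

theorem abs_dirD_admWord_le (w : SpaceTime → ℝ) (p v : SpaceTime) {k : ℕ} (hk : k ≤ 2)
    (μ : Fin k → Fin 8) :
    |dirD v (admWord μ w) p| ≤ 4 * ‖v‖ * Real.sqrt (energy w p) :=
  (abs_dirD_le _ _ _).trans
    (mul_le_mul_of_nonneg_left (gradAbs_admWord_le_sqrt w p hk μ) (by positivity))

theorem abs_dirD_le_sqrt (w : SpaceTime → ℝ) (p v : SpaceTime) :
    |dirD v w p| ≤ 4 * ‖v‖ * Real.sqrt (energy w p) := by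
  simpa [admWord_zero] using abs_dirD_admWord_le w p v (k := 0) (by norm_num) Fin.elim0

theorem abs_dirD_adm_le (w : SpaceTime → ℝ) (p v : SpaceTime) (k : Fin 8) :
    |dirD v (adm k w) p| ≤ 4 * ‖v‖ * Real.sqrt (energy w p) := by
  simpa [admWord_zero, admWord_cons] using
    abs_dirD_admWord_le w p v (k := 1) (by norm_num) (Fin.cons k Fin.elim0)

theorem abs_dirD_adm_adm_le (w : SpaceTime → ℝ) (p v : SpaceTime) (j k : Fin 8) :
    |dirD v (adm j (adm k w)) p| ≤ 4 * ‖v‖ * Real.sqrt (energy w p) := by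
  simpa [admWord_zero, admWord_cons] using
    abs_dirD_admWord_le w p v (k := 2) (by norm_num) (Fin.cons j (Fin.cons k Fin.elim0))

theorem Smooth.abs_adm_dirD_le {w : SpaceTime → ℝ} (hw : Smooth w) {p : SpaceTime}
    (hp : p ∈ future) {v : SpaceTime} (hv : ‖v‖ ≤ 1) (k : Fin 8) :
    |WaveDecay.adm k (WaveDecay.dirD v w) p| ≤ 8 * linBound * Real.sqrt (energy w p) := by
  rw [hw.adm_dirD k v hp]
  have hM := one_le_linBound
  have hG := Real.sqrt_nonneg (energy w p)
  have hl : ‖lin k v‖ ≤ linBound := (norm_lin_le k v).trans (by nlinarith [norm_nonneg v])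
  have h1 := abs_dirD_adm_le w p v k
  have h2 := abs_dirD_le_sqrt w p (lin k v)
  have h3 : ‖v‖ * Real.sqrt (energy w p) ≤ linBound * Real.sqrt (energy w p) :=
    mul_le_mul_of_nonneg_right (hv.trans hM) hG
  have h4 : ‖lin k v‖ * Real.sqrt (energy w p) ≤ linBound * Real.sqrt (energy w p) :=
    mul_le_mul_of_nonneg_right hl hG
  refine (abs_sub _ _).trans ?_
  linarith

/-- Moving both fields inside the constant-coefficient derivative yields four terms, each a
derivative of some `Z^μ w` with `|μ| ≤ 2` in a direction of length at most `linBound ^ 2`. -/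
theorem Smooth.abs_adm_adm_dirD_le {w : SpaceTime → ℝ} (hw : Smooth w) {p : SpaceTime}
    (hp : p ∈ future) {v : SpaceTime} (hv : ‖v‖ ≤ 1) (j k : Fin 8) :
    |WaveDecay.adm j (WaveDecay.adm k (WaveDecay.dirD v w)) p| ≤
      16 * linBound ^ 2 * Real.sqrt (energy w p) := by
  rw [hw.adm_adm_dirD j k v hp]
  have hM := one_le_linBound
  have hG := Real.sqrt_nonneg (energy w p)
  have hl : ∀ k, ‖lin k v‖ ≤ linBound := fun k =>
    (norm_lin_le k v).trans (by nlinarith [norm_nonneg v])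
  have hMM : linBound ≤ linBound ^ 2 := by nlinarith
  have key : ∀ u : SpaceTime, ‖u‖ ≤ linBound ^ 2 →
      4 * ‖u‖ * Real.sqrt (energy w p) ≤ 4 * linBound ^ 2 * Real.sqrt (energy w p) :=
    fun u hu => mul_le_mul_of_nonneg_right (by linarith) hG
  have h1 := (abs_dirD_adm_adm_le w p v j k).trans (key _ (by linarith))
  have h2 := (abs_dirD_adm_le w p (lin j v) k).trans (key _ ((hl j).trans hMM))
  have h3 := (abs_dirD_adm_le w p (lin k v) j).trans (key _ ((hl k).trans hMM))
  have h4 := (abs_dirD_le_sqrt w p (lin j (lin k v))).trans (key _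
    ((norm_lin_le j _).trans (by nlinarith [hl k])))
  rw [abs_le] at *
  constructor <;> linarith

namespace Smooth

variable {w : SpaceTime → ℝ}

theorem gradSq_continuousOn (hw : Smooth w) : ContinuousOn (gradSq w) future :=
  (hw.dt.continuousOn.pow 2).add
    (continuousOn_finsetSum _ fun i _ => (hw.dx i).continuousOn.pow 2)

theorem energy_continuousOn (hw : Smooth w) : ContinuousOn (energy w) future :=
  continuousOn_finsetSum _ fun _ _ => continuousOn_finsetSum _ fun μ _ =>
    (hw.admWord μ).gradSq_continuousOn

/-- Along a curve whose velocity is a combination of admissible fields, differentiation in the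
parameter produces only admissible derivatives. Two such differentiations therefore stay within
words of length two. -/
theorem hasDerivAt_comp (hw : Smooth w) {γ : ℝ → SpaceTime} {a : Fin 8 → ℝ → ℝ} {s : ℝ}
    (hγ : HasDerivAt γ (∑ k, a k s • fld k (γ s)) s) (hs : γ s ∈ future) :
    HasDerivAt (fun s => w (γ s)) (∑ k, a k s * WaveDecay.adm k w (γ s)) s := by
  have h := (hw.differentiableAt hs).hasFDerivAt.comp_hasDerivAt s hγ
  simp only [map_sum, map_smul, smul_eq_mul, ← adm_eq] at h
  exact h

end Smooth

/-! ### Taylor's formula along curves -/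

theorem sq_intervalIntegral_le {f : ℝ → ℝ} (hf : ContinuousOn f (Icc 0 1)) :
    (∫ u in (0 : ℝ)..1, f u) ^ 2 ≤ ∫ u in (0 : ℝ)..1, f u ^ 2 := by
  set A := ∫ u in (0 : ℝ)..1, f u with hA
  have hf' : ContinuousOn f (uIcc 0 1) := by rwa [uIcc_of_le zero_le_one]
  have h1 : IntervalIntegrable f volume 0 1 := hf'.intervalIntegrable
  have h2 : IntervalIntegrable (fun u => f u ^ 2) volume 0 1 := (hf'.pow 2).intervalIntegrable
  -- Cauchy–Schwarz on the unit interval, as nonnegativity of the variance.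
  have h : 0 ≤ ∫ u in (0 : ℝ)..1, (f u - A) ^ 2 :=
    intervalIntegral.integral_nonneg zero_le_one fun _ _ => sq_nonneg _
  have e : ∀ u, (f u - A) ^ 2 = f u ^ 2 - 2 * A * f u + A ^ 2 := fun u => by ring
  simp only [e] at h
  rw [intervalIntegral.integral_add (h2.sub (h1.const_mul _)) (by simp),
    intervalIntegral.integral_sub h2 (h1.const_mul _), intervalIntegral.integral_const_mul,
    ← hA] at h
  simp at h
  nlinarith

theorem ofReal_intervalIntegral {f : ℝ → ℝ} {a b : ℝ} (hab : a ≤ b)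
    (hf : ContinuousOn f (Icc a b)) (h0 : ∀ u ∈ Icc a b, 0 ≤ f u) :
    ENNReal.ofReal (∫ u in a..b, f u) = ∫⁻ u in Ioc a b, ENNReal.ofReal (f u) := by
  have hi : IntervalIntegrable f volume a b :=
    ContinuousOn.intervalIntegrable (by rwa [uIcc_of_le hab])
  rw [intervalIntegral.integral_of_le hab, ofReal_integral_eq_lintegral_ofReal
    ((intervalIntegrable_iff_integrableOn_Ioc_of_le hab).1 hi)]
  filter_upwards [ae_restrict_mem measurableSet_Ioc] with u hu
  exact h0 u ⟨hu.1.le, hu.2⟩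

/-- A second-order Taylor formula at the left end point, with the substitution `s = u ^ 2`. -/
theorem abs_le_integral_of_hasDerivAt {g g1 g2 G : ℝ → ℝ}
    (hg : ∀ s ∈ Icc (0 : ℝ) 1, HasDerivAt g (g1 s) s)
    (hg1 : ∀ s ∈ Icc (0 : ℝ) 1, HasDerivAt g1 (g2 s) s)
    (hg2 : ContinuousOn g2 (Icc 0 1)) (hG : ContinuousOn G (Icc 0 1))
    (hb : ∀ s ∈ Icc (0 : ℝ) 1, 2 * (|g2 s| + 4 * |g1 s| + 2 * |g s|) ≤ G s) :
    |g 0| ≤ ∫ u in (0 : ℝ)..1, u ^ 3 * G (u ^ 2) := by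
  have hsq : ∀ u ∈ Icc (0 : ℝ) 1, u ^ 2 ∈ Icc (0 : ℝ) 1 := fun u hu =>
    ⟨sq_nonneg u, pow_le_one₀ hu.1 hu.2⟩
  have hsqm : MapsTo (fun u : ℝ => u ^ 2) (Icc 0 1) (Icc 0 1) := hsq
  have hsqc : ContinuousOn (fun u : ℝ => u ^ 2) (Icc 0 1) := by fun_prop
  -- With `φ s = (1 - s) ^ 2 * g s`, this is `P = s φ' - φ`, so `P' = s φ''`. The cutoff makes `φ`
  -- and `φ'` vanish at `1`, hence the integral of `P'` is `φ 0 = g 0`.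
  set P : ℝ → ℝ := fun s => s * ((1 - s) ^ 2 * g1 s - 2 * (1 - s) * g s) - (1 - s) ^ 2 * g s
  set P' : ℝ → ℝ := fun s => s * ((1 - s) ^ 2 * g2 s - 4 * (1 - s) * g1 s + 2 * g s)
  have hP : ∀ s ∈ Icc (0 : ℝ) 1, HasDerivAt P (P' s) s := by
    intro s hs
    have h1 : HasDerivAt (fun s : ℝ => 1 - s) (-1) s := by
      simpa using (hasDerivAt_id s).const_sub 1
    have h := ((hasDerivAt_id s).mul (((h1.pow 2).mul (hg1 s hs)).sub
      ((h1.const_mul 2).mul (hg s hs)))).sub ((h1.pow 2).mul (hg s hs))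
    refine h.congr_deriv ?_
    simp only [P', id, Pi.pow_apply, Pi.mul_apply, Pi.sub_apply]
    push_cast
    ring
  have hgc : ContinuousOn g (Icc 0 1) := fun s hs => (hg s hs).continuousAt.continuousWithinAt
  have hg1c : ContinuousOn g1 (Icc 0 1) := fun s hs => (hg1 s hs).continuousAt.continuousWithinAt
  have hP'c : ContinuousOn P' (Icc 0 1) := by fun_prop
  have hQ : ∀ u ∈ uIcc (0 : ℝ) 1, HasDerivAt (fun u => P (u ^ 2)) (P' (u ^ 2) * (2 * u)) u := by
    intro u hu
    rw [uIcc_of_le zero_le_one] at hu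
    have := HasDerivAt.comp (h₂ := P) (h := fun u : ℝ => u ^ 2) u (hP _ (hsq u hu))
      (hasDerivAt_pow 2 u)
    simpa [Function.comp_def] using this
  have hc : ContinuousOn (fun u => P' (u ^ 2) * (2 * u)) (Icc 0 1) :=
    (hP'c.comp hsqc hsqm).mul (by fun_prop)
  have hftc := intervalIntegral.integral_eq_sub_of_hasDerivAt hQ
    (ContinuousOn.intervalIntegrable (by rwa [uIcc_of_le zero_le_one]))
  have hP0 : P ((1 : ℝ) ^ 2) - P ((0 : ℝ) ^ 2) = g 0 := by simp [P]
  rw [hP0] at hftc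
  rw [← hftc, ← Real.norm_eq_abs]
  refine intervalIntegral.norm_integral_le_of_norm_le zero_le_one ?_
    (ContinuousOn.intervalIntegrable ?_)
  · filter_upwards with u hu
    have hu' : u ∈ Icc (0 : ℝ) 1 := ⟨hu.1.le, hu.2⟩
    have hs := hsq u hu'
    have hbs := hb _ hs
    set s := u ^ 2
    have e : P' s * (2 * u) = u ^ 3 * (2 * ((1 - s) ^ 2 * g2 s - 4 * (1 - s) * g1 s + 2 * g s)) := by
      simp only [P', s]; ring
    rw [e, Real.norm_eq_abs, abs_mul, abs_of_nonneg (pow_nonneg hu'.1 3)]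
    refine mul_le_mul_of_nonneg_left (le_trans ?_ hbs) (pow_nonneg hu'.1 3)
    rw [abs_mul, abs_two]
    have h1 : |(1 - s) ^ 2 * g2 s| ≤ |g2 s| := by
      rw [abs_mul]
      refine mul_le_of_le_one_left (abs_nonneg _) ?_
      rw [abs_of_nonneg (sq_nonneg _)]
      exact pow_le_one₀ (by linarith [hs.2]) (by linarith [hs.1])
    have h2 : |4 * (1 - s) * g1 s| ≤ 4 * |g1 s| := by
      rw [abs_mul]
      refine mul_le_mul_of_nonneg_right ?_ (abs_nonneg _)
      rw [abs_of_nonneg (by linarith [hs.2])]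
      linarith [hs.1]
    have h3 : |2 * g s| = 2 * |g s| := by rw [abs_mul, abs_two]
    have h4 := abs_add_le ((1 - s) ^ 2 * g2 s - 4 * (1 - s) * g1 s) (2 * g s)
    have h5 := abs_sub ((1 - s) ^ 2 * g2 s) (4 * (1 - s) * g1 s)
    linarith
  · rw [uIcc_of_le zero_le_one]
    exact ContinuousOn.mul (by fun_prop) (hG.comp hsqc hsqm)

/-- The constant of the path estimate. -/
def pathConst : ℝ := (10000 * linBound ^ 2) ^ 2

/-- The substitution `s = u ^ 2` matters here. Applied directly to `∫ s φ'' ds`, Cauchy–Schwarz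
leaves the weight `s ^ 2`, which does not absorb the Jacobian `s ^ 3` of a three-dimensional
contraction. In the variable `u` the weight becomes `u ^ 6`, which is exactly that Jacobian. -/
theorem Smooth.sq_dirD_path_le {w : SpaceTime → ℝ} (hw : Smooth w) {v : SpaceTime} (hv : ‖v‖ ≤ 1)
    {γ : ℝ → SpaceTime} {a a' : Fin 8 → ℝ → ℝ}
    (hγ : ∀ s ∈ Icc (0 : ℝ) 1, HasDerivAt γ (∑ k, a k s • fld k (γ s)) s)
    (ha : ∀ k, ∀ s ∈ Icc (0 : ℝ) 1, HasDerivAt (a k) (a' k s) s)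
    (hac : ∀ k, ContinuousOn (a' k) (Icc 0 1))
    (hb : ∀ k, ∀ s ∈ Icc (0 : ℝ) 1, |a k s| ≤ 2)
    (hb' : ∀ k, ∀ s ∈ Icc (0 : ℝ) 1, |a' k s| ≤ 2)
    (hf : ∀ s ∈ Icc (0 : ℝ) 1, γ s ∈ future) :
    ENNReal.ofReal (WaveDecay.dirD v w (γ 0) ^ 2) ≤ ENNReal.ofReal pathConst *
      ∫⁻ u in Ioc (0 : ℝ) 1, ENNReal.ofReal (u ^ 6 * energy w (γ (u ^ 2))) := by
  have hM := one_le_linBound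
  have hsqm : MapsTo (fun u : ℝ => u ^ 2) (Icc 0 1) (Icc 0 1) := fun u hu =>
    ⟨sq_nonneg u, pow_le_one₀ hu.1 hu.2⟩
  have hγc : ContinuousOn γ (Icc 0 1) := fun s hs => (hγ s hs).continuousAt.continuousWithinAt
  have hacc : ∀ k, ContinuousOn (a k) (Icc 0 1) := fun k s hs =>
    (ha k s hs).continuousAt.continuousWithinAt
  set f := WaveDecay.dirD v w with hfdef
  have hfs : Smooth f := hw.dirD v
  set g1 : ℝ → ℝ := fun s => ∑ k, a k s * WaveDecay.adm k f (γ s)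
  set g2 : ℝ → ℝ := fun s => ∑ k, (a' k s * WaveDecay.adm k f (γ s) +
    a k s * ∑ j, a j s * WaveDecay.adm j (WaveDecay.adm k f) (γ s))
  -- The bounds `b2`, `b1`, `b0` below add up to 2 (4224 + 4 · 128 + 2 · 4) = 9488 ≤ 10000.
  set G : ℝ → ℝ := fun s => 10000 * linBound ^ 2 * Real.sqrt (energy w (γ s))
  have hec : ContinuousOn (fun s => energy w (γ s)) (Icc 0 1) :=
    hw.energy_continuousOn.comp hγc hf
  have hGc : ContinuousOn G (Icc 0 1) := continuousOn_const.mul hec.sqrt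
  have key : |f (γ 0)| ≤ ∫ u in (0 : ℝ)..1, u ^ 3 * G (u ^ 2) := by
    refine abs_le_integral_of_hasDerivAt (g := fun s => f (γ s)) (g1 := g1) (g2 := g2)
      (fun s hs => hfs.hasDerivAt_comp (hγ s hs) (hf s hs)) ?_ ?_ hGc ?_
    · intro s hs
      exact HasDerivAt.fun_sum fun k _ =>
        (ha k s hs).fun_mul ((hfs.adm k).hasDerivAt_comp (hγ s hs) (hf s hs))
    · refine continuousOn_finsetSum _ fun k _ => ContinuousOn.add
        ((hac k).mul ((hfs.adm k).continuousOn.comp hγc hf)) ((hacc k).mul ?_)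
      exact continuousOn_finsetSum _ fun j _ =>
        (hacc j).mul (((hfs.adm k).adm j).continuousOn.comp hγc hf)
    · intro s hs
      have hp := hf s hs
      have hS := Real.sqrt_nonneg (energy w (γ s))
      set S := Real.sqrt (energy w (γ s)) with hSdef
      have b0 : |f (γ s)| ≤ 4 * S :=
        (abs_dirD_le_sqrt w (γ s) v).trans (mul_le_mul_of_nonneg_right (by linarith) hS)
      have b1 : |g1 s| ≤ 8 * (2 * (8 * linBound * S)) := by
        refine (Finset.abs_sum_le_sum_abs _ _).trans ?_
        refine (Finset.sum_le_card_nsmul _ _ (2 * (8 * linBound * S)) ?_).trans (by simp)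
        intro k _
        rw [abs_mul]
        exact mul_le_mul (hb k s hs) (hw.abs_adm_dirD_le hp hv k) (abs_nonneg _) (by norm_num)
      have b2 : |g2 s| ≤ 8 * (2 * (8 * linBound * S) + 2 * (8 * (2 * (16 * linBound ^ 2 * S)))) := by
        refine (Finset.abs_sum_le_sum_abs _ _).trans ?_
        refine (Finset.sum_le_card_nsmul _ _
          (2 * (8 * linBound * S) + 2 * (8 * (2 * (16 * linBound ^ 2 * S)))) ?_).trans
          (by rw [Finset.card_univ, Fintype.card_fin, nsmul_eq_mul]; norm_num)
        intro k _
        refine (abs_add_le _ _).trans (add_le_add ?_ ?_)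
        · rw [abs_mul]
          exact mul_le_mul (hb' k s hs) (hw.abs_adm_dirD_le hp hv k) (abs_nonneg _) (by norm_num)
        · rw [abs_mul]
          refine mul_le_mul (hb k s hs) ?_ (abs_nonneg _) (by norm_num)
          refine (Finset.abs_sum_le_sum_abs _ _).trans ?_
          refine (Finset.sum_le_card_nsmul _ _ (2 * (16 * linBound ^ 2 * S)) ?_).trans (by simp)
          intro j _
          rw [abs_mul]
          exact mul_le_mul (hb j s hs) (hw.abs_adm_adm_dirD_le hp hv j k) (abs_nonneg _)
            (by norm_num)
      have hMM : linBound * S ≤ linBound ^ 2 * S :=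
        mul_le_mul_of_nonneg_right (by nlinarith) hS
      have hM1 : S ≤ linBound ^ 2 * S := le_mul_of_one_le_left hS (by nlinarith)
      show 2 * (|g2 s| + 4 * |g1 s| + 2 * |f (γ s)|) ≤ 10000 * linBound ^ 2 * S
      linarith
  have hc3 : ContinuousOn (fun u : ℝ => u ^ 3 * G (u ^ 2)) (Icc 0 1) :=
    ContinuousOn.mul (by fun_prop) (hGc.comp (by fun_prop) hsqm)
  have hsq : f (γ 0) ^ 2 ≤ pathConst *
      ∫ u in (0 : ℝ)..1, u ^ 6 * energy w (γ (u ^ 2)) := by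
    rw [← sq_abs]
    refine (pow_le_pow_left₀ (abs_nonneg _) key 2).trans ((sq_intervalIntegral_le hc3).trans ?_)
    rw [← intervalIntegral.integral_const_mul]
    refine le_of_eq (intervalIntegral.integral_congr fun u _ => ?_)
    simp only [G, pathConst]
    have := Real.sq_sqrt (energy_nonneg w (γ (u ^ 2)))
    calc _ = (10000 * linBound ^ 2) ^ 2 * (u ^ 6 * Real.sqrt (energy w (γ (u ^ 2))) ^ 2) := by ring
      _ = _ := by rw [this]
  refine (ENNReal.ofReal_le_ofReal hsq).trans ?_
  rw [ENNReal.ofReal_mul (by unfold pathConst; positivity), ofReal_intervalIntegral zero_le_one]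
  · exact ContinuousOn.mul (by fun_prop) (hec.comp (by fun_prop) hsqm)
  · intro u hu
    exact mul_nonneg (pow_nonneg hu.1 6) (energy_nonneg _ _)

/-! ### Changes of variables and averaging over families of curves -/

section ChangeOfVariables

variable {E : Type*} [NormedAddCommGroup E] [NormedSpace ℝ E] [MeasurableSpace E] [BorelSpace E]
  [FiniteDimensional ℝ E] (μ : Measure E) [μ.IsAddHaarMeasure]

theorem lintegral_comp_linearMap {f : E →ₗ[ℝ] E} (hf : LinearMap.det f ≠ 0) {q : E → ℝ≥0∞}
    (hq : Measurable q) :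
    ∫⁻ y, q (f y) ∂μ = ENNReal.ofReal |(LinearMap.det f)⁻¹| * ∫⁻ y, q y ∂μ := by
  have hm : Measurable f := f.continuous_of_finiteDimensional.measurable
  rw [← lintegral_map hq hm, Measure.map_linearMap_addHaar_eq_smul_addHaar μ hf,
    lintegral_smul_measure, smul_eq_mul]

theorem lintegral_comp_smul_of_pos {r : ℝ} (hr : 0 < r) {q : E → ℝ≥0∞} (hq : Measurable q) :
    ∫⁻ y, q (r • y) ∂μ = ENNReal.ofReal (r ^ Module.finrank ℝ E)⁻¹ * ∫⁻ y, q y ∂μ := by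
  rw [← lintegral_map hq (measurable_const_smul r), Measure.map_addHaar_smul μ hr.ne',
    lintegral_smul_measure, smul_eq_mul, abs_of_pos (by positivity)]

end ChangeOfVariables

theorem lintegral_comp_mul_of_pos {r : ℝ} (hr : 0 < r) {q : ℝ → ℝ≥0∞} (hq : Measurable q) :
    ∫⁻ y, q (r * y) = ENNReal.ofReal r⁻¹ * ∫⁻ y, q y := by
  simpa using lintegral_comp_smul_of_pos volume hr hq

theorem lintegral_comp_smul_E3 {r : ℝ} (hr : 0 < r) {q : E3 → ℝ≥0∞} (hq : Measurable q) :
    ∫⁻ y, q (r • y) = ENNReal.ofReal (r ^ 3)⁻¹ * ∫⁻ y, q y := by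
  simpa using lintegral_comp_smul_of_pos volume hr hq

/-- The map fixing `e` and scaling the orthogonal complement of the unit vector `e` by `s`. -/
def squash (e : E3) (s : ℝ) : E3 →ₗ[ℝ] E3 where
  toFun y := s • y + ((1 - s) * ⟪e, y⟫) • e
  map_add' y z := by simp only [inner_add_right, smul_add, mul_add, add_smul]; abel
  map_smul' c y := by
    simp only [inner_smul_right, smul_add, RingHom.id_apply, smul_smul]
    congr 2 <;> ring

theorem squash_apply (e y : E3) (s : ℝ) :
    squash e s y = s • y + ((1 - s) * ⟪e, y⟫) • e := rfl

/-- The map is `s` times a transvection of determinant `1 + (1 - s) / s = 1 / s`, and `s ^ 3 / s = s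
^ 2`. -/
theorem det_squash {e : E3} (he : ‖e‖ = 1) {s : ℝ} (hs : s ≠ 0) :
    LinearMap.det (squash e s) = s ^ 2 := by
  have h : squash e s = s • LinearMap.transvection
      (((1 - s) / s) • (innerSL ℝ e : E3 →L[ℝ] ℝ).toLinearMap) e := by
    ext1 y
    simp only [squash_apply, LinearMap.smul_apply, LinearMap.transvection.apply, smul_add]
    congr 1
    rw [smul_smul]
    congr 1
    simp
    field_simp
  rw [h, LinearMap.det_smul, LinearMap.transvection.det]
  simp [he]
  field_simp
  ring

theorem measurable_squash (e : E3) :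
    Measurable fun z : ℝ × E3 => squash e z.1 z.2 := by
  have : Continuous fun z : ℝ × E3 => squash e z.1 z.2 := by
    simp only [squash_apply]
    fun_prop
  exact this.measurable

/-- Contracting `σ` by `u ^ 2` and the plane orthogonal to `e` by `u ^ 2` has Jacobian `u ^ 2 * u ^
4`, which cancels the weight. The component along `e` is an inert parameter, reserved for the radial
integration. -/
theorem lintegral_squash {e : E3} (he : ‖e‖ = 1) {q : ℝ × E3 → ℝ≥0∞} (hq : Measurable q)
    {u : ℝ} (hu : 0 < u) :
    ∫⁻ z : ℝ × E3, ENNReal.ofReal (u ^ 6) * q (u ^ 2 * z.1, squash e (u ^ 2) z.2) =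
      ∫⁻ σ, ∫⁻ y, q (σ, y) := by
  have hs : Measurable fun y : E3 => squash e (u ^ 2) y :=
    (squash e (u ^ 2)).continuous_of_finiteDimensional.measurable
  have hm : Measurable fun z : ℝ × E3 =>
      ENNReal.ofReal (u ^ 6) * q (u ^ 2 * z.1, squash e (u ^ 2) z.2) :=
    measurable_const.mul (hq.comp ((measurable_fst.const_mul _).prodMk (hs.comp measurable_snd)))
  have hd : LinearMap.det (squash e (u ^ 2)) = u ^ 4 := by
    rw [det_squash he (by positivity)]; ring
  have hI : Measurable fun σ : ℝ => ∫⁻ y, q (σ, y) := hq.lintegral_prod_right'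
  have h2 : ∀ σ : ℝ, ∫⁻ y, ENNReal.ofReal (u ^ 6) * q (u ^ 2 * σ, squash e (u ^ 2) y) =
      ENNReal.ofReal (u ^ 6 * (u ^ 4)⁻¹) * ∫⁻ y, q (u ^ 2 * σ, y) := by
    intro σ
    have hqs : Measurable fun y : E3 => q (u ^ 2 * σ, y) := hq.comp measurable_prodMk_left
    rw [lintegral_const_mul' _ _ ENNReal.ofReal_ne_top,
      lintegral_comp_linearMap volume (by rw [hd]; positivity) hqs, hd,
      abs_of_pos (by positivity), ← mul_assoc, ← ENNReal.ofReal_mul (by positivity)]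
  rw [Measure.volume_eq_prod, lintegral_prod _ hm.aemeasurable]
  simp only [h2]
  rw [lintegral_const_mul' _ _ ENNReal.ofReal_ne_top,
    lintegral_comp_mul_of_pos (r := u ^ 2) (by positivity) hI, ← mul_assoc,
    ← ENNReal.ofReal_mul (by positivity)]
  have : u ^ 6 * (u ^ 4)⁻¹ * (u ^ 2)⁻¹ = 1 := by field_simp
  rw [this, ENNReal.ofReal_one, one_mul]

/-- The left side does not depend on the curve, so the bound may be integrated over all parameters
`(σ, y)`. After exchanging integrals, every `u` contributes the same amount, and `u` ranges over an
interval of length one. -/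
theorem average_le {e : E3} (he : ‖e‖ = 1) {q : ℝ × E3 → ℝ≥0∞} (hq : Measurable q) {A : ℝ≥0∞}
    {c : ℝ} {B : Set E3} (hB : MeasurableSet B)
    (h : ∀ σ ∈ Icc 0 c, ∀ y ∈ B, A ≤
      ∫⁻ u in Ioc (0 : ℝ) 1, ENNReal.ofReal (u ^ 6) * q (u ^ 2 * σ, squash e (u ^ 2) y)) :
    A * (ENNReal.ofReal c * volume B) ≤ ∫⁻ σ, ∫⁻ y, q (σ, y) := by
  have hΦm : Measurable fun z : (ℝ × E3) × ℝ =>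
      ENNReal.ofReal (z.2 ^ 6) * q (z.2 ^ 2 * z.1.1, squash e (z.2 ^ 2) z.1.2) := by
    have h1 : Measurable fun z : (ℝ × E3) × ℝ => squash e (z.2 ^ 2) z.1.2 :=
      (measurable_squash e).comp
        ((measurable_snd.pow_const 2).prodMk (measurable_snd.comp measurable_fst))
    exact (measurable_snd.pow_const 6).ennreal_ofReal.mul (hq.comp
      (((measurable_snd.pow_const 2).mul (measurable_fst.comp measurable_fst)).prodMk h1))
  have hS : MeasurableSet ((Icc (0 : ℝ) c) ×ˢ B) := measurableSet_Icc.prod hB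
  have h1 : A * (ENNReal.ofReal c * volume B) = ∫⁻ _ in (Icc (0 : ℝ) c) ×ˢ B, A := by
    rw [setLIntegral_const, Measure.volume_eq_prod, Measure.prod_prod, Real.volume_Icc, sub_zero]
  rw [h1]
  refine (setLIntegral_mono' hS fun z hz => h z.1 hz.1 z.2 hz.2).trans ?_
  refine (setLIntegral_le_lintegral _ _).trans ?_
  rw [lintegral_lintegral_swap hΦm.aemeasurable]
  rw [setLIntegral_congr_fun measurableSet_Ioc fun u hu => lintegral_squash he hq hu.1]
  simp

/-- The fundamental theorem of calculus gives a pointwise bound by a mean. -/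
theorem mul_le_integral_of_hasDerivAt {h h' G : ℝ → ℝ} {L : ℝ} (hL : 0 ≤ L)
    (hd : ∀ ρ ∈ Icc 0 L, HasDerivAt h (h' ρ) ρ) (hc : ContinuousOn h' (Icc 0 L))
    (hG : ContinuousOn G (Icc 0 L)) (hb : ∀ ρ ∈ Icc 0 L, |h ρ| + L * |h' ρ| ≤ G ρ) :
    L * h 0 ≤ ∫ ρ in (0 : ℝ)..L, G ρ := by
  -- The primitive vanishes at `L` and equals `-L * h 0` at `0`.
  have hD : ∀ ρ ∈ uIcc 0 L, HasDerivAt (fun ρ => (ρ - L) * h ρ) (h ρ + (ρ - L) * h' ρ) ρ := by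
    intro ρ hρ
    rw [uIcc_of_le hL] at hρ
    have := ((hasDerivAt_id ρ).sub_const L).fun_mul (hd ρ hρ)
    simpa using this
  have hhc : ContinuousOn h (Icc 0 L) := fun s hs => (hd s hs).continuousAt.continuousWithinAt
  have hftc := intervalIntegral.integral_eq_sub_of_hasDerivAt hD
    (ContinuousOn.intervalIntegrable (by rw [uIcc_of_le hL]; fun_prop))
  have e : L * h 0 = ∫ ρ in (0 : ℝ)..L, (h ρ + (ρ - L) * h' ρ) := by rw [hftc]; ring
  rw [e]
  refine intervalIntegral.integral_mono_on hL
    (ContinuousOn.intervalIntegrable (by rw [uIcc_of_le hL]; fun_prop))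
    (ContinuousOn.intervalIntegrable (by rwa [uIcc_of_le hL])) fun ρ hρ => ?_
  refine le_trans ?_ (hb ρ hρ)
  have h1 := le_abs_self (h ρ)
  have h2 : (ρ - L) * h' ρ ≤ L * |h' ρ| := by
    refine (le_abs_self _).trans ?_
    rw [abs_mul]
    refine mul_le_mul_of_nonneg_right ?_ (abs_nonneg _)
    rw [abs_le]
    constructor <;> linarith [hρ.1, hρ.2]
  linarith

/-! ### Curves generated by scaling with translations or with rotations -/

/-- Coefficients expressing scaling, translation and rotation along a curve. -/
def coef (a : Fin 3 → ℝ) (b : Fin 3 → ℝ) (c : ℝ) : Fin 8 → ℝ :=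
  ![0, a 0, a 1, a 2, b 0, b 1, b 2, c]

theorem coef_ind {P : ℝ → Prop} {a b : Fin 3 → ℝ} {c : ℝ} (h0 : P 0) (ha : ∀ i, P (a i))
    (hb : ∀ i, P (b i)) (hc : P c) (k : Fin 8) : P (coef a b c k) := by
  fin_cases k
  exacts [h0, ha 0, ha 1, ha 2, hb 0, hb 1, hb 2, hc]

theorem sum_coef_smul_fld (a b : Fin 3 → ℝ) (c : ℝ) (p : SpaceTime) :
    ∑ k, coef a b c k • fld k p =
      (0, ∑ i, a i • (EuclideanSpace.single i 1 : E3)) + ∑ i, b i • rotFld i p + c • p := by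
  have h0 : fld 0 p = (1, 0) := rfl
  have h1 : fld 1 p = (0, EuclideanSpace.single 0 1) := rfl
  have h2 : fld 2 p = (0, EuclideanSpace.single 1 1) := rfl
  have h3 : fld 3 p = (0, EuclideanSpace.single 2 1) := rfl
  have h4 : fld 4 p = rotFld 0 p := rfl
  have h5 : fld 5 p = rotFld 1 p := rfl
  have h6 : fld 6 p = rotFld 2 p := rfl
  have h7 : fld 7 p = p := rfl
  have c0 : coef a b c 0 = 0 := rfl
  have c1 : coef a b c 1 = a 0 := rfl
  have c2 : coef a b c 2 = a 1 := rfl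
  have c3 : coef a b c 3 = a 2 := rfl
  have c4 : coef a b c 4 = b 0 := rfl
  have c5 : coef a b c 5 = b 1 := rfl
  have c6 : coef a b c 6 = b 2 := rfl
  have c7 : coef a b c 7 = c := rfl
  rw [Fin.sum_univ_eight, h0, h1, h2, h3, h4, h5, h6, h7, c0, c1, c2, c3, c4, c5, c6, c7,
    Fin.sum_univ_three, Fin.sum_univ_three]
  refine Prod.ext ?_ ?_
  · simp
  · simp
    abel

section ScalingCoefficient

variable {σ s : ℝ}

theorem half_le_one_sub (hσ : σ ∈ Icc (0 : ℝ) (1 / 2)) (hs : s ∈ Icc (0 : ℝ) 1) :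
    1 / 2 ≤ 1 - s * σ ∧ 1 - s * σ ≤ 1 := by
  constructor <;> nlinarith [hσ.1, hσ.2, hs.1, hs.2]

theorem hasDerivAt_scalCoef (hσ : σ ∈ Icc (0 : ℝ) (1 / 2)) (hs : s ∈ Icc (0 : ℝ) 1) :
    HasDerivAt (fun s : ℝ => -σ / (1 - s * σ)) (-(σ ^ 2) / (1 - s * σ) ^ 2) s := by
  have h := half_le_one_sub hσ hs
  have h1 : HasDerivAt (fun s : ℝ => 1 - s * σ) (-σ) s := by
    simpa using ((hasDerivAt_id s).mul_const σ).const_sub 1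
  refine ((hasDerivAt_const s (-σ)).fun_div h1 (by linarith)).congr_deriv ?_
  ring

theorem abs_scalCoef_le (hσ : σ ∈ Icc (0 : ℝ) (1 / 2)) (hs : s ∈ Icc (0 : ℝ) 1) :
    |-σ / (1 - s * σ)| ≤ 2 := by
  have h := half_le_one_sub hσ hs
  rw [abs_div, abs_neg, abs_of_nonneg hσ.1, abs_of_pos (by linarith), div_le_iff₀ (by linarith)]
  linarith [hσ.2]

theorem abs_scalCoef_deriv_le (hσ : σ ∈ Icc (0 : ℝ) (1 / 2)) (hs : s ∈ Icc (0 : ℝ) 1) :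
    |-(σ ^ 2) / (1 - s * σ) ^ 2| ≤ 2 := by
  have h := half_le_one_sub hσ hs
  rw [abs_div, abs_neg, abs_of_nonneg (sq_nonneg σ), abs_of_pos (by nlinarith),
    div_le_iff₀ (by nlinarith)]
  nlinarith [hσ.1, hσ.2]

theorem continuousOn_scalCoef_deriv (hσ : σ ∈ Icc (0 : ℝ) (1 / 2)) :
    ContinuousOn (fun s : ℝ => -(σ ^ 2) / (1 - s * σ) ^ 2) (Icc 0 1) := by
  refine ContinuousOn.div (by fun_prop) (by fun_prop) fun s hs => ?_
  have h := half_le_one_sub hσ hs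
  nlinarith

end ScalingCoefficient

/-- The curve `(1 - sσ)(t, x + sξ)` has velocity `-σ/(1 - sσ) S + (1 - sσ) ξ·∇`. The bound `σ ≤ 1/2`
keeps the coefficients and their derivatives below 2. -/
theorem Smooth.sq_dirD_le_translation {w : SpaceTime → ℝ} (hw : Smooth w) {v : SpaceTime}
    (hv : ‖v‖ ≤ 1) {t σ : ℝ} (ht : 0 < t) (hσ : σ ∈ Icc (0 : ℝ) (1 / 2)) (x : E3) {ξ : E3}
    (hξ : ‖ξ‖ ≤ 1) :
    ENNReal.ofReal (WaveDecay.dirD v w (t, x) ^ 2) ≤ ENNReal.ofReal pathConst *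
      ∫⁻ u in Ioc (0 : ℝ) 1, ENNReal.ofReal
        (u ^ 6 * energy w ((1 - u ^ 2 * σ) • ((t, x + u ^ 2 • ξ) : SpaceTime))) := by
  set γ : ℝ → SpaceTime := fun s => (1 - s * σ) • ((t, x + s • ξ) : SpaceTime) with hγdef
  have hξi : ∀ i, |ξ i| ≤ 1 := fun i => (abs_apply_le_norm ξ i).trans hξ
  have h := hw.sq_dirD_path_le hv (γ := γ)
    (a := fun k s => coef (fun i => (1 - s * σ) * ξ i) 0 (-σ / (1 - s * σ)) k)
    (a' := fun k s => coef (fun i => -σ * ξ i) 0 (-(σ ^ 2) / (1 - s * σ) ^ 2) k)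
    ?_ ?_ ?_ ?_ ?_ ?_
  · simpa [hγdef] using h
  · intro s hs
    have hp := half_le_one_sub hσ hs
    have h1 : HasDerivAt (fun s : ℝ => 1 - s * σ) (-σ) s := by
      simpa using ((hasDerivAt_id s).mul_const σ).const_sub 1
    have h2 : HasDerivAt (fun s : ℝ => x + s • ξ) ξ s := by
      simpa using ((hasDerivAt_id s).smul_const ξ).const_add x
    refine (h1.fun_smul ((hasDerivAt_const s t).prodMk h2)).congr_deriv ?_
    rw [sum_coef_smul_fld]
    have e : ∑ i, ((1 - s * σ) * ξ i) • (EuclideanSpace.single i 1 : E3) = (1 - s * σ) • ξ := by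
      simp only [mul_smul]
      rw [← Finset.smul_sum, ← eq_sum_single]
    have hsc : (-σ / (1 - s * σ)) • γ s = (-σ) • ((t, x + s • ξ) : SpaceTime) := by
      simp only [hγdef, smul_smul]
      rw [div_mul_cancel₀ _ (by linarith)]
    rw [e, hsc]
    simp
  · intro k s hs
    have h1 : HasDerivAt (fun s : ℝ => 1 - s * σ) (-σ) s := by
      simpa using ((hasDerivAt_id s).mul_const σ).const_sub 1
    fin_cases k
    exacts [hasDerivAt_const _ _, h1.mul_const _, h1.mul_const _, h1.mul_const _,
      hasDerivAt_const _ _, hasDerivAt_const _ _, hasDerivAt_const _ _, hasDerivAt_scalCoef hσ hs]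
  · intro k
    fin_cases k
    exacts [continuousOn_const, continuousOn_const, continuousOn_const, continuousOn_const,
      continuousOn_const, continuousOn_const, continuousOn_const, continuousOn_scalCoef_deriv hσ]
  · intro k s hs
    refine coef_ind (P := fun y => |y| ≤ 2) (by simp) (fun i => ?_) (by simp)
      (abs_scalCoef_le hσ hs) k
    have hp := half_le_one_sub hσ hs
    rw [abs_mul, abs_of_nonneg (by linarith : 0 ≤ 1 - s * σ)]
    nlinarith [hξi i, abs_nonneg (ξ i)]
  · intro k s hs
    refine coef_ind (P := fun y => |y| ≤ 2) (by simp) (fun i => ?_) (by simp)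
      (abs_scalCoef_deriv_le hσ hs) k
    rw [abs_mul, abs_neg, abs_of_nonneg hσ.1]
    nlinarith [hξi i, abs_nonneg (ξ i), hσ.2, hσ.1]
  · intro s hs
    have hp := half_le_one_sub hσ hs
    show 0 < (1 - s * σ) * t
    exact mul_pos (by linarith) ht

theorem inner_eq_sum (x y : E3) : ⟪x, y⟫ = x 0 * y 0 + x 1 * y 1 + x 2 * y 2 := by
  simp [PiLp.inner_apply, Fin.sum_univ_three, mul_comm]

theorem norm_sq_eq_sum (x : E3) : ‖x‖ ^ 2 = x 0 ^ 2 + x 1 ^ 2 + x 2 ^ 2 := by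
  simp [EuclideanSpace.norm_sq_eq, Fin.sum_univ_three]

/-- The components of the cross product. -/
def crossE (x y : E3) (i : Fin 3) : ℝ := x (i + 1) * y (i + 2) - x (i + 2) * y (i + 1)

theorem abs_crossE_le (x y : E3) (i : Fin 3) : |crossE x y i| ≤ 2 * ‖x‖ * ‖y‖ := by
  unfold crossE
  have h : ∀ i j, |x i * y j| ≤ ‖x‖ * ‖y‖ := fun i j => by
    rw [abs_mul]
    exact mul_le_mul (abs_apply_le_norm x i) (abs_apply_le_norm y j) (abs_nonneg _) (norm_nonneg _)
  have h1 := h (i + 1) (i + 2)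
  have h2 := h (i + 2) (i + 1)
  have h3 := abs_sub (x (i + 1) * y (i + 2)) (x (i + 2) * y (i + 1))
  linarith

/-- The rotation about the axis `x × ξ` moves `x + sξ` within the plane of `x` and `ξ`. Divided by
`‖x + sξ‖²`, it gives the velocity of the radial projection of this line to a sphere. -/
theorem rotation_identity {x ξ : E3} (h : ⟪x, ξ⟫ = 0) (s t : ℝ) :
    ∑ i, crossE x ξ i • rotFld i (t, x + s • ξ) =
      (0, (-(s * ‖ξ‖ ^ 2)) • (x + s • ξ) + (‖x‖ ^ 2 + s ^ 2 * ‖ξ‖ ^ 2) • ξ) := by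
  rw [inner_eq_sum] at h
  refine Prod.ext (by simp [rotFld, Prod.fst_sum]) ?_
  rw [norm_sq_eq_sum, norm_sq_eq_sum]
  ext j
  fin_cases j
  · simp [rotFld, crossE, Fin.sum_univ_three]
    linear_combination (s * ξ 0 - x 0) * h
  · simp [rotFld, crossE, Fin.sum_univ_three]
    linear_combination (s * ξ 1 - x 1) * h
  · simp [rotFld, crossE, Fin.sum_univ_three]
    linear_combination (s * ξ 2 - x 2) * h

theorem rotFld_smul (i : Fin 3) (c : ℝ) (p : SpaceTime) : rotFld i (c • p) = c • rotFld i p :=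
  (rotLin i).map_smul c p

/-- The line `x + sξ` is projected to the sphere of radius `‖x‖` and then scaled by `1 - sσ`. Only
rotations and scaling occur, so no translation spoils the bounds at large radius. -/
theorem Smooth.sq_dirD_le_rotation {w : SpaceTime → ℝ} (hw : Smooth w) {v : SpaceTime}
    (hv : ‖v‖ ≤ 1) {t σ : ℝ} (ht : 0 < t) (hσ : σ ∈ Icc (0 : ℝ) (1 / 2)) {x ξ : E3}
    (hx : x ≠ 0) (hξ : ‖ξ‖ ≤ ‖x‖ / 2) (horth : ⟪x, ξ⟫ = 0) :
    ENNReal.ofReal (WaveDecay.dirD v w (t, x) ^ 2) ≤ ENNReal.ofReal pathConst *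
      ∫⁻ u in Ioc (0 : ℝ) 1, ENNReal.ofReal (u ^ 6 * energy w ((1 - u ^ 2 * σ) •
        ((t, (‖x‖ / ‖x + u ^ 2 • ξ‖) • (x + u ^ 2 • ξ)) : SpaceTime))) := by
  have hr : 0 < ‖x‖ := norm_pos_iff.2 hx
  set n : ℝ → ℝ := fun s => ‖x‖ ^ 2 + s ^ 2 * ‖ξ‖ ^ 2 with hn
  have hn0 : ∀ s, ‖x‖ ^ 2 ≤ n s := fun s => le_add_of_nonneg_right (by positivity)
  have hnpos : ∀ s, 0 < n s := fun s => lt_of_lt_of_le (by positivity) (hn0 s)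
  have hnorm : ∀ s, ‖x + s • ξ‖ = Real.sqrt (n s) := by
    intro s
    rw [eq_comm, Real.sqrt_eq_iff_mul_self_eq (hnpos s).le (norm_nonneg _), ← pow_two,
      norm_add_sq_real, inner_smul_right, horth, norm_smul, mul_pow, Real.norm_eq_abs, sq_abs]
    simp [hn]
  have hnd : ∀ s, HasDerivAt n (2 * s * ‖ξ‖ ^ 2) s := fun s => by
    have := ((hasDerivAt_pow 2 s).mul_const (‖ξ‖ ^ 2)).const_add (‖x‖ ^ 2)
    simpa [hn] using this
  set γ : ℝ → SpaceTime := fun s =>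
    (1 - s * σ) • ((t, (‖x‖ / Real.sqrt (n s)) • (x + s • ξ)) : SpaceTime) with hγdef
  have hξx : ‖ξ‖ ^ 2 ≤ ‖x‖ ^ 2 / 4 := by nlinarith [norm_nonneg ξ]
  have hcr : ∀ i, |crossE x ξ i| ≤ ‖x‖ ^ 2 := fun i =>
    (abs_crossE_le x ξ i).trans (by nlinarith)
  have h := hw.sq_dirD_path_le hv (γ := γ)
    (a := fun k s => coef 0 (fun i => crossE x ξ i / n s) (-σ / (1 - s * σ)) k)
    (a' := fun k s => coef 0 (fun i => -(crossE x ξ i * (2 * s * ‖ξ‖ ^ 2)) / n s ^ 2)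
      (-(σ ^ 2) / (1 - s * σ) ^ 2) k)
    ?_ ?_ ?_ ?_ ?_ ?_
  · have h0 : γ 0 = (t, x) := by
      simp [hγdef, hn, Real.sqrt_sq hr.le, div_self hr.ne']
    rw [h0] at h
    simp only [hnorm]
    exact h
  · intro s hs
    have hp := half_le_one_sub hσ hs
    have hsq : 0 < Real.sqrt (n s) := Real.sqrt_pos.2 (hnpos s)
    have h1 : HasDerivAt (fun s : ℝ => 1 - s * σ) (-σ) s := by
      simpa using ((hasDerivAt_id s).mul_const σ).const_sub 1
    have h2 : HasDerivAt (fun s : ℝ => x + s • ξ) ξ s := by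
      simpa using ((hasDerivAt_id s).smul_const ξ).const_add x
    have h3 : HasDerivAt (fun s => ‖x‖ / Real.sqrt (n s))
        (‖x‖ / Real.sqrt (n s) * (-(s * ‖ξ‖ ^ 2) / n s)) s := by
      refine ((hasDerivAt_const s ‖x‖).fun_div ((hnd s).sqrt (hnpos s).ne') hsq.ne').congr_deriv ?_
      rw [Real.sq_sqrt (hnpos s).le]
      field_simp
      ring
    refine (h1.fun_smul ((hasDerivAt_const s t).prodMk (h3.fun_smul h2))).congr_deriv ?_
    rw [sum_coef_smul_fld]
    have hg : γ s = ((1 - s * σ) * (‖x‖ / Real.sqrt (n s))) •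
        ((t / (‖x‖ / Real.sqrt (n s)), x + s • ξ) : SpaceTime) := by
      have : ‖x‖ / Real.sqrt (n s) ≠ 0 := (div_pos hr hsq).ne'
      refine Prod.ext ?_ ?_
      · simp [hγdef]; field_simp
      · simp only [hγdef, Prod.smul_snd, smul_smul]
    have hrot : ∑ i, (crossE x ξ i / n s) • rotFld i (γ s) =
        ((1 - s * σ) * (‖x‖ / Real.sqrt (n s)) / n s) • ((0, (-(s * ‖ξ‖ ^ 2)) • (x + s • ξ) +
          (n s) • ξ) : SpaceTime) := by
      rw [← rotation_identity horth s (t / (‖x‖ / Real.sqrt (n s))), Finset.smul_sum]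
      refine Finset.sum_congr rfl fun i _ => ?_
      rw [hg, rotFld_smul, smul_smul, smul_smul]
      congr 1
      ring
    rw [hrot]
    have hns := (hnpos s).ne'
    have hsc : (-σ / (1 - s * σ)) • γ s =
        (-σ) • ((t, (‖x‖ / Real.sqrt (n s)) • (x + s • ξ)) : SpaceTime) := by
      simp only [hγdef, smul_smul]
      rw [div_mul_cancel₀ _ (by linarith)]
    rw [hsc]
    refine Prod.ext ?_ ?_
    · simp
    · simp only [Pi.zero_apply, zero_smul, Finset.sum_const_zero, Prod.snd_add, Prod.smul_snd,
        Prod.mk_zero_zero, zero_add, smul_add, smul_smul]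
      have e1 : (1 - s * σ) * (‖x‖ / Real.sqrt (n s)) / n s * n s =
        (1 - s * σ) * (‖x‖ / Real.sqrt (n s)) := by field_simp
      rw [e1]
      have e2 : (1 - s * σ) * (‖x‖ / Real.sqrt (n s)) / n s * -(s * ‖ξ‖ ^ 2) =
        (1 - s * σ) * (‖x‖ / Real.sqrt (n s) * (-(s * ‖ξ‖ ^ 2) / n s)) := by ring
      rw [e2]
      have e3 : (1 - s * σ) * (‖x‖ / Real.sqrt (n s)) / n s * (-(s * ‖ξ‖ ^ 2) * s) =
        (1 - s * σ) * (‖x‖ / Real.sqrt (n s) * (-(s * ‖ξ‖ ^ 2) / n s) * s) := by ring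
      rw [e3]
      abel
  · intro k s hs
    have hd : ∀ i, HasDerivAt (fun s => crossE x ξ i / n s)
        (-(crossE x ξ i * (2 * s * ‖ξ‖ ^ 2)) / n s ^ 2) s := fun i => by
      refine ((hasDerivAt_const s _).fun_div (hnd s) (hnpos s).ne').congr_deriv ?_
      ring
    fin_cases k
    exacts [hasDerivAt_const _ _, hasDerivAt_const _ _, hasDerivAt_const _ _, hasDerivAt_const _ _,
      hd 0, hd 1, hd 2, hasDerivAt_scalCoef hσ hs]
  · intro k
    have hd : ∀ i, ContinuousOn (fun s => -(crossE x ξ i * (2 * s * ‖ξ‖ ^ 2)) / n s ^ 2)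
        (Icc 0 1) := fun i =>
      ContinuousOn.div (by fun_prop) (by simp only [hn]; fun_prop)
        fun s _ => pow_ne_zero 2 (hnpos s).ne'
    fin_cases k
    exacts [continuousOn_const, continuousOn_const, continuousOn_const, continuousOn_const,
      hd 0, hd 1, hd 2, continuousOn_scalCoef_deriv hσ]
  · intro k s hs
    refine coef_ind (P := fun y => |y| ≤ 2) (by simp) (by simp) (fun i => ?_)
      (abs_scalCoef_le hσ hs) k
    rw [abs_div, abs_of_pos (hnpos s), div_le_iff₀ (hnpos s)]
    linarith [hcr i, hn0 s, hnpos s]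
  · intro k s hs
    refine coef_ind (P := fun y => |y| ≤ 2) (by simp) (by simp) (fun i => ?_)
      (abs_scalCoef_deriv_le hσ hs) k
    have h1 : |2 * s * ‖ξ‖ ^ 2| ≤ ‖x‖ ^ 2 := by
      rw [abs_of_nonneg (by have := hs.1; positivity)]
      nlinarith [hs.1, hs.2, sq_nonneg ‖ξ‖]
    rw [abs_div, abs_neg, abs_mul, abs_of_pos (pow_pos (hnpos s) 2),
      div_le_iff₀ (pow_pos (hnpos s) 2)]
    have h2 := mul_le_mul ((hcr i).trans (hn0 s)) (h1.trans (hn0 s)) (abs_nonneg _) (hnpos s).le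
    nlinarith [hnpos s]
  · intro s hs
    have hp := half_le_one_sub hσ hs
    show 0 < (1 - s * σ) * t
    exact mul_pos (by linarith) ht

/-! ### Integration along radial segments -/

theorem Smooth.box {w : SpaceTime → ℝ} (hw : Smooth w) : Smooth (box w) :=
  ContDiffOn.sub hw.dt.dt (ContDiffOn.sum fun i _ => (hw.dx i).dx i)

theorem Smooth.gradZ_continuousOn {w : SpaceTime → ℝ} (hw : Smooth w) (N : ℕ) :
    ContinuousOn (gradZ N w) future :=
  continuousOn_finsetSum _ fun _ _ => continuousOn_finsetSum _ fun μ _ =>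
    (hw.admWord μ).gradSq_continuousOn.sqrt

theorem Smooth.boxZ_continuousOn {w : SpaceTime → ℝ} (hw : Smooth w) (N : ℕ) :
    ContinuousOn (boxZ N w) future :=
  continuousOn_finsetSum _ fun _ _ => continuousOn_finsetSum _ fun μ _ =>
    (hw.admWord μ).box.continuousOn.abs

/-- The quadratic density on the right-hand side of the estimates. -/
def majorant (κ : ℝ) (w : SpaceTime → ℝ) : SpaceTime → ℝ :=
  fun p => gradZ 3 w p ^ 2 + κ ^ 2 * boxZ 2 w p ^ 2

theorem majorant_nonneg (κ : ℝ) (w : SpaceTime → ℝ) (p : SpaceTime) : 0 ≤ majorant κ w p := by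
  unfold majorant; positivity

theorem Smooth.majorant_continuousOn {w : SpaceTime → ℝ} (hw : Smooth w) (κ : ℝ) :
    ContinuousOn (majorant κ w) future :=
  ((hw.gradZ_continuousOn 3).pow 2).add
    (continuousOn_const.mul ((hw.boxZ_continuousOn 2).pow 2))

theorem measurable_indicator_ofReal {X : Type*} [TopologicalSpace X] [MeasurableSpace X]
    [OpensMeasurableSpace X] {S : Set X} (hS : MeasurableSet S) {f : X → ℝ}
    (hf : ContinuousOn f S) : Measurable (S.indicator fun z => ENNReal.ofReal (f z)) := by
  classical
  have h : Measurable (S.piecewise (fun z => ENNReal.ofReal (f z)) fun _ => 0) :=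
    ContinuousOn.measurable_piecewise (ENNReal.continuous_ofReal.comp_continuousOn hf)
      continuousOn_const hS
  change Measurable (S.piecewise _ 0) at h
  rwa [piecewise_eq_indicator] at h

/-- The majorant restricted to a region. -/
def density (E : Set SpaceTime) (κ : ℝ) (w : SpaceTime → ℝ) : SpaceTime → ℝ≥0∞ :=
  E.indicator fun p => ENNReal.ofReal (majorant κ w p)

theorem Smooth.measurable_density {w : SpaceTime → ℝ} (hw : Smooth w) {E : Set SpaceTime}
    (hE : MeasurableSet E) (hEf : E ⊆ future) (κ : ℝ) : Measurable (density E κ w) :=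
  measurable_indicator_ofReal hE ((hw.majorant_continuousOn κ).mono hEf)

/-- Control at `p` of the derivatives in direction `θ` of the gradients of `Z^μ w`, `|μ| ≤ 2`. -/
def HessBound (L κ C : ℝ) (w : SpaceTime → ℝ) (θ p : SpaceTime) : Prop :=
  ∀ k ≤ 2, ∀ μ : Fin k → Fin 8,
    L * |dirD θ (dt (admWord μ w)) p| ≤ C * (gradZ 3 w p + κ * boxZ 2 w p) ∧
    ∀ i, L * |dirD θ (dx i (admWord μ w)) p| ≤ C * (gradZ 3 w p + κ * boxZ 2 w p)

theorem HessBound.neg {L κ C : ℝ} {w : SpaceTime → ℝ} {θ p : SpaceTime}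
    (h : HessBound L κ C w θ p) : HessBound L κ C w (-θ) p := by
  have e : ∀ f, |dirD (-θ) f p| = |dirD θ f p| := fun f => by
    unfold dirD
    rw [map_neg, abs_neg]
  intro k hk μ
  simp only [e]
  exact h k hk μ

/-- The derivative of `gradSq f` in direction `θ`. -/
def gradSqDeriv (θ : SpaceTime) (f : SpaceTime → ℝ) (p : SpaceTime) : ℝ :=
  2 * dt f p * dirD θ (dt f) p + ∑ i, 2 * dx i f p * dirD θ (dx i f) p

theorem Smooth.hasDerivAt_line {f : SpaceTime → ℝ} (hf : Smooth f) {z θ : SpaceTime} {ρ : ℝ}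
    (hp : z + ρ • θ ∈ future) :
    HasDerivAt (fun ρ : ℝ => f (z + ρ • θ)) (WaveDecay.dirD θ f (z + ρ • θ)) ρ := by
  have h : HasDerivAt (fun ρ : ℝ => z + ρ • θ) θ ρ := by
    simpa using ((hasDerivAt_id ρ).smul_const θ).const_add z
  exact (hf.differentiableAt hp).hasFDerivAt.comp_hasDerivAt ρ h

theorem Smooth.hasDerivAt_gradSq_line {f : SpaceTime → ℝ} (hf : Smooth f) {z θ : SpaceTime} {ρ : ℝ}
    (hp : z + ρ • θ ∈ future) :
    HasDerivAt (fun ρ : ℝ => gradSq f (z + ρ • θ)) (gradSqDeriv θ f (z + ρ • θ)) ρ := by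
  refine ((hf.dt.hasDerivAt_line hp).fun_pow 2 |>.fun_add (HasDerivAt.fun_sum fun i _ =>
    ((hf.dx i).hasDerivAt_line hp).fun_pow 2)).congr_deriv ?_
  simp [gradSqDeriv]

theorem Smooth.gradSqDeriv_continuousOn {f : SpaceTime → ℝ} (hf : Smooth f) (θ : SpaceTime) :
    ContinuousOn (gradSqDeriv θ f) future :=
  ((continuousOn_const.mul hf.dt.continuousOn).mul (hf.dt.dirD θ).continuousOn).add
    (continuousOn_finsetSum _ fun i _ =>
      (continuousOn_const.mul (hf.dx i).continuousOn).mul ((hf.dx i).dirD θ).continuousOn)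

theorem sum_words_le {F : ∀ k : ℕ, (Fin k → Fin 8) → ℝ} {B : ℝ}
    (h : ∀ k ≤ 2, ∀ μ : Fin k → Fin 8, F k μ ≤ B) :
    ∑ k ∈ Finset.range 3, ∑ μ : Fin k → Fin 8, F k μ ≤ 73 * B := by
  have hk : ∀ k ≤ 2, ∑ μ : Fin k → Fin 8, F k μ ≤ (8 : ℝ) ^ k * B := by
    intro k hk
    exact (Finset.sum_le_card_nsmul _ _ B fun μ _ => h k hk μ).trans (by simp)
  rw [Finset.sum_range_succ, Finset.sum_range_succ, Finset.sum_range_one]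
  have h0 := hk 0 (by norm_num)
  have h1 := hk 1 (by norm_num)
  have h2 := hk 2 (by norm_num)
  linarith

theorem mul_abs_gradSqDeriv_le {L κ C : ℝ} (hL : 0 ≤ L) (hC : 0 ≤ C) {w : SpaceTime → ℝ}
    {θ p : SpaceTime} (h : HessBound L κ C w θ p) {k : ℕ} (hk : k ≤ 2) (μ : Fin k → Fin 8) :
    L * |gradSqDeriv θ (admWord μ w) p| ≤ 16 * C * majorant κ w p := by
  obtain ⟨ht, hx⟩ := h k hk μ
  set f := admWord μ w
  set g := gradZ 3 w p
  set b := κ * boxZ 2 w p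
  have hg : gradAbs f p ≤ g := gradAbs_admWord_le w p (by omega) μ
  have hg0 : 0 ≤ g := gradZ_nonneg _ _ _
  have key : ∀ a d : ℝ, |a| ≤ gradAbs f p → L * |d| ≤ C * (g + b) →
      L * |2 * a * d| ≤ 4 * C * majorant κ w p := by
    intro a d ha hd
    have e : L * |2 * a * d| = 2 * (|a| * (L * |d|)) := by
      rw [abs_mul, abs_mul, abs_two]; ring
    have h1 : |a| * (L * |d|) ≤ g * (C * (g + b)) :=
      mul_le_mul (ha.trans hg) hd (by positivity) hg0
    have h2 : g * (g + b) ≤ 2 * (g ^ 2 + b ^ 2) := by nlinarith [sq_nonneg (g - b)]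
    have h3 : majorant κ w p = g ^ 2 + b ^ 2 := by simp only [majorant, g, b]; ring
    rw [e, h3]
    nlinarith
  have h0 := key _ _ (abs_dt_le f p) ht
  have h1 := key _ _ (abs_dx_le 0 f p) (hx 0)
  have h2 := key _ _ (abs_dx_le 1 f p) (hx 1)
  have h3 := key _ _ (abs_dx_le 2 f p) (hx 2)
  unfold gradSqDeriv
  rw [Fin.sum_univ_three]
  refine (mul_le_mul_of_nonneg_left ((abs_add_le _ _).trans (add_le_add le_rfl
    (abs_add_three _ _ _))) hL).trans ?_
  linarith

/-- The constant of the radial estimate. -/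
def segConst (C : ℝ) : ℝ := 73 + 1168 * C

/-- The energy at an endpoint is at most its mean plus the integral of its derivative. That
derivative is a product of a gradient with a radial derivative of a gradient, and `HessBound` turns
`L` times this product into the majorant. -/
theorem Smooth.energy_le_segment {w : SpaceTime → ℝ} (hw : Smooth w) {E : Set SpaceTime}
    (hEf : E ⊆ future) {L κ C : ℝ} (hL : 0 ≤ L) (hC : 0 ≤ C) {z θ : SpaceTime}
    (hE : ∀ ρ ∈ Icc 0 L, z + ρ • θ ∈ E)
    (hb : ∀ ρ ∈ Icc 0 L, HessBound L κ C w θ (z + ρ • θ)) :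
    ENNReal.ofReal L * ENNReal.ofReal (energy w z) ≤ ENNReal.ofReal (segConst C) *
      ∫⁻ ρ in Ioc 0 L, density E κ w (z + ρ • θ) := by
  have hlc : ContinuousOn (fun ρ : ℝ => z + ρ • θ) (Icc 0 L) := by fun_prop
  have hlf : MapsTo (fun ρ : ℝ => z + ρ • θ) (Icc 0 L) future := fun ρ hρ => hEf (hE ρ hρ)
  have hmc : ContinuousOn (fun ρ : ℝ => majorant κ w (z + ρ • θ)) (Icc 0 L) :=
    (hw.majorant_continuousOn κ).comp hlc hlf
  have hC' : 0 ≤ segConst C := by unfold segConst; linarith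
  have key := mul_le_integral_of_hasDerivAt hL (h := fun ρ => energy w (z + ρ • θ))
    (h' := fun ρ => ∑ k ∈ Finset.range 3, ∑ μ : Fin k → Fin 8,
      gradSqDeriv θ (WaveDecay.admWord μ w) (z + ρ • θ))
    (G := fun ρ => segConst C * majorant κ w (z + ρ • θ)) ?_ ?_ (continuousOn_const.mul hmc) ?_
  · simp only [zero_smul, add_zero] at key
    rw [← ENNReal.ofReal_mul hL]
    refine (ENNReal.ofReal_le_ofReal key).trans ?_
    rw [intervalIntegral.integral_const_mul, ENNReal.ofReal_mul hC',
      ofReal_intervalIntegral hL hmc fun _ _ => majorant_nonneg _ _ _]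
    refine mul_le_mul_right (setLIntegral_mono' measurableSet_Ioc fun ρ hρ => ?_) _
    rw [density, indicator_of_mem (hE ρ ⟨hρ.1.le, hρ.2⟩)]
  · intro ρ hρ
    exact HasDerivAt.fun_sum fun k _ => HasDerivAt.fun_sum fun μ _ =>
      (hw.admWord μ).hasDerivAt_gradSq_line (hlf hρ)
  · exact continuousOn_finsetSum _ fun k _ => continuousOn_finsetSum _ fun μ _ =>
      ((hw.admWord μ).gradSqDeriv_continuousOn θ).comp hlc hlf
  · intro ρ hρ
    set p := z + ρ • θ
    have hm := majorant_nonneg κ w p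
    have h1 : |energy w p| ≤ 73 * majorant κ w p := by
      rw [abs_of_nonneg (energy_nonneg _ _)]
      refine (energy_le_sq_gradZ w p).trans (mul_le_mul_of_nonneg_left ?_ (by norm_num))
      exact le_add_of_nonneg_right (by positivity)
    have h2 : L * |∑ k ∈ Finset.range 3, ∑ μ : Fin k → Fin 8,
        gradSqDeriv θ (WaveDecay.admWord μ w) p| ≤ 73 * (16 * C * majorant κ w p) := by
      refine le_trans ?_ (sum_words_le (F := fun k μ => L * |gradSqDeriv θ (WaveDecay.admWord μ w) p|)
        fun k hk μ => mul_abs_gradSqDeriv_le hL hC (hb ρ hρ) hk μ)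
      simp only [← Finset.mul_sum]
      refine mul_le_mul_of_nonneg_left ?_ hL
      exact (Finset.abs_sum_le_sum_abs _ _).trans
        (Finset.sum_le_sum fun k _ => Finset.abs_sum_le_sum_abs _ _)
    unfold segConst
    linarith

/-! ### From curve parameters back to space-time integrals -/

theorem lintegral_time {I : ℝ → ℝ≥0∞} (hI : Measurable I) {t : ℝ} (ht : 0 < t) :
    ∫⁻ σ, I ((1 - σ) * t) = ENNReal.ofReal t⁻¹ * ∫⁻ s, I s := by
  rw [← lintegral_comp_mul_of_pos ht hI, ← lintegral_sub_left_eq_self _ (1 : ℝ)]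
  simp [mul_comm]

theorem lintegral_affine {H : E3 → ℝ≥0∞} (hH : Measurable H) {m : ℝ} (hm : 1 / 2 ≤ m)
    (x z : E3) : ∫⁻ y, H (m • (x + y) + z) ≤ ENNReal.ofReal 8 * ∫⁻ y, H y := by
  have h1 : ∫⁻ y, H (m • (x + y) + z) = ∫⁻ y, H (m • y + z) :=
    lintegral_add_left_eq_self (fun y => H (m • y + z)) x
  have h2 := lintegral_comp_smul_E3 (r := m) (by linarith) (q := fun y => H (y + z))
    (hH.comp (measurable_id.add_const z))
  rw [h1, h2, lintegral_add_right_eq_self]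
  refine mul_le_mul_left (ENNReal.ofReal_le_ofReal ?_) _
  rw [inv_le_comm₀ (by positivity) (by norm_num)]
  have := pow_le_pow_left₀ (by norm_num) hm 3
  norm_num at this ⊢
  linarith

/-- Only the part of `y` orthogonal to `e` enters, so the `y`-integral alone covers a plane. The
segment variable `ρ` supplies the third dimension. -/
theorem lintegral_translation {H : E3 → ℝ≥0∞} (hH : Measurable H) {m : ℝ} (hm : m ∈ Icc (1 / 2) 1)
    (x : E3) {e : E3} (he : ‖e‖ = 1) :
    ∫⁻ y in Metric.closedBall (0 : E3) (1 / 32), ∫⁻ ρ in Ioc (0 : ℝ) (1 / 32),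
      H (m • (x + (y - ⟪e, y⟫ • e)) + ρ • e) ≤ ENNReal.ofReal 16 * ∫⁻ y, H y := by
  have hswap : Measurable fun z : E3 × ℝ => H (m • (x + z.1) + z.2 • e) :=
    hH.comp (by fun_prop)
  calc _ ≤ ∫⁻ y in Metric.closedBall (0 : E3) (1 / 32), ∫⁻ ρ in Icc (-1 : ℝ) 1,
        H (m • (x + y) + ρ • e) := by
        refine setLIntegral_mono' Metric.isClosed_closedBall.measurableSet fun y hy => ?_
        set b := m * ⟪e, y⟫ with hb
        have hb1 : |b| ≤ 1 / 32 := by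
          rw [hb, abs_mul, abs_of_nonneg (by linarith [hm.1])]
          have h1 := abs_real_inner_le_norm e y
          rw [he, one_mul] at h1
          have h2 : ‖y‖ ≤ 1 / 32 := by simpa using hy
          have h3 := hm.2
          nlinarith [abs_nonneg ⟪e, y⟫, hm.1]
        rw [abs_le] at hb1
        -- Shifting `ρ` by `m * ⟪e, y⟫` restores the deleted component of `y`; the argument becomes
        -- `m • (x + y) + ρ • e`.
        rw [← lintegral_indicator measurableSet_Ioc, ← lintegral_indicator measurableSet_Icc,
          ← lintegral_add_right_eq_self _ b]
        refine lintegral_mono fun ρ => ?_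
        beta_reduce
        by_cases hρ : ρ + b ∈ Ioc (0 : ℝ) (1 / 32)
        swap
        · rw [indicator_of_notMem hρ]
          exact zero_le
        rw [indicator_of_mem hρ, indicator_of_mem (by constructor <;> linarith [hρ.1, hρ.2])]
        refine le_of_eq (congrArg H ?_)
        simp only [hb, add_smul, smul_add, smul_sub, mul_smul]
        abel
    _ ≤ ∫⁻ y, ∫⁻ ρ in Icc (-1 : ℝ) 1, H (m • (x + y) + ρ • e) := setLIntegral_le_lintegral _ _
    _ = ∫⁻ ρ in Icc (-1 : ℝ) 1, ∫⁻ y, H (m • (x + y) + ρ • e) :=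
        lintegral_lintegral_swap hswap.aemeasurable
    _ ≤ ∫⁻ _ in Icc (-1 : ℝ) 1, ENNReal.ofReal 8 * ∫⁻ y, H y :=
        lintegral_mono fun ρ => lintegral_affine hH hm.1 x _
    _ = ENNReal.ofReal 16 * ∫⁻ y, H y := by
        rw [setLIntegral_const, Real.volume_Icc, mul_right_comm, ← ENNReal.ofReal_mul (by norm_num)]
        norm_num

/-- Only the direction of `x + y` enters. Taking `l = (m‖x‖ - ρ)/‖x + y‖` as the new segment
variable makes the argument `l • (x + y)`, with `l` between 1/2 and 2. For fixed `l` this is an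
affine change of variables in `y`; the constant is 24 = 2 · (3/2) · 8. -/
theorem lintegral_radial {H : E3 → ℝ≥0∞} (hH : Measurable H) {m L : ℝ} (hm : m ∈ Icc (31 / 32) 1)
    {x : E3} (hx : x ≠ 0) (hL : L ≤ ‖x‖ / 4) :
    ∫⁻ y in Metric.closedBall (0 : E3) (‖x‖ / 32), ∫⁻ ρ in Ioc (0 : ℝ) L,
      H (((m * ‖x‖ - ρ) / ‖x + y‖) • (x + y)) ≤ ENNReal.ofReal (24 * ‖x‖) * ∫⁻ y, H y := by
  have hr : 0 < ‖x‖ := norm_pos_iff.2 hx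
  have hswap : Measurable fun z : E3 × ℝ => H (z.2 • (x + z.1)) := hH.comp (by fun_prop)
  calc _ ≤ ∫⁻ y in Metric.closedBall (0 : E3) (‖x‖ / 32), ENNReal.ofReal (2 * ‖x‖) *
        ∫⁻ l in Icc (1 / 2 : ℝ) 2, H (l • (x + y)) := by
        refine setLIntegral_mono' Metric.isClosed_closedBall.measurableSet fun y hy => ?_
        have hy' : ‖y‖ ≤ ‖x‖ / 32 := by simpa using hy
        have hz1 : ‖x + y‖ ≤ 33 / 32 * ‖x‖ := (norm_add_le _ _).trans (by linarith)
        have hz2 : 31 / 32 * ‖x‖ ≤ ‖x + y‖ := by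
          have := norm_sub_le (x + y) y
          rw [add_sub_cancel_right] at this
          linarith
        have hz : 0 < ‖x + y‖ := by linarith
        set q : ℝ → ℝ≥0∞ := (Icc (1 / 2 : ℝ) 2).indicator fun l => H (l • (x + y)) with hq
        have hqm : Measurable q :=
          Measurable.indicator (hH.comp (by fun_prop)) measurableSet_Icc
        have h1 : ∫⁻ ρ, q ((m * ‖x‖ - ρ) / ‖x + y‖) = ENNReal.ofReal ‖x + y‖ * ∫⁻ l, q l := by
          have h2 := lintegral_comp_mul_of_pos (r := ‖x + y‖⁻¹) (by positivity) hqm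
          rw [inv_inv] at h2
          rw [← h2, ← lintegral_sub_left_eq_self (fun ρ => q (‖x + y‖⁻¹ * ρ)) (m * ‖x‖)]
          simp only [div_eq_inv_mul]
        rw [← lintegral_indicator measurableSet_Icc (fun l => H (l • (x + y)))]
        refine le_trans ?_ (mul_le_mul_left (ENNReal.ofReal_le_ofReal
          (by linarith : ‖x + y‖ ≤ 2 * ‖x‖)) _)
        rw [← h1, ← lintegral_indicator measurableSet_Ioc]
        refine lintegral_mono fun ρ => ?_
        beta_reduce
        by_cases hρ : ρ ∈ Ioc (0 : ℝ) L
        swap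
        · rw [indicator_of_notMem hρ]
          exact zero_le
        rw [indicator_of_mem hρ, hq, indicator_of_mem]
        constructor
        · rw [le_div_iff₀ hz]
          nlinarith [hm.1, hρ.2]
        · rw [div_le_iff₀ hz]
          nlinarith [hm.2, hρ.1]
    _ ≤ ∫⁻ y, ENNReal.ofReal (2 * ‖x‖) * ∫⁻ l in Icc (1 / 2 : ℝ) 2, H (l • (x + y)) :=
        setLIntegral_le_lintegral _ _
    _ = ENNReal.ofReal (2 * ‖x‖) * ∫⁻ l in Icc (1 / 2 : ℝ) 2, ∫⁻ y, H (l • (x + y)) := by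
        rw [lintegral_const_mul' _ _ ENNReal.ofReal_ne_top,
          lintegral_lintegral_swap hswap.aemeasurable]
    _ ≤ ENNReal.ofReal (2 * ‖x‖) * ∫⁻ _ in Icc (1 / 2 : ℝ) 2, ENNReal.ofReal 8 * ∫⁻ y, H y := by
        refine mul_le_mul_right (setLIntegral_mono' measurableSet_Icc fun l hl => ?_) _
        simpa using lintegral_affine hH hl.1 x 0
    _ = ENNReal.ofReal (24 * ‖x‖) * ∫⁻ y, H y := by
        rw [setLIntegral_const, Real.volume_Icc, mul_right_comm (ENNReal.ofReal 8),
          ← ENNReal.ofReal_mul (by norm_num), ← mul_assoc, ← ENNReal.ofReal_mul (by positivity)]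
        congr 2
        ring

theorem norm_squash_le {e : E3} (he : ‖e‖ = 1) {s : ℝ} (hs : s ∈ Icc (0 : ℝ) 1) (y : E3) :
    ‖squash e s y‖ ≤ ‖y‖ := by
  rw [squash_apply]
  refine (norm_add_le _ _).trans ?_
  rw [norm_smul, norm_smul, he, mul_one, Real.norm_eq_abs, Real.norm_eq_abs, abs_mul,
    abs_of_nonneg hs.1, abs_of_nonneg (by linarith [hs.2] : 0 ≤ 1 - s)]
  have h1 := abs_real_inner_le_norm e y
  rw [he, one_mul] at h1
  nlinarith [hs.2]

theorem average_le_of_const {e : E3} (he : ‖e‖ = 1) {q : ℝ × E3 → ℝ≥0∞} (hq : Measurable q)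
    {A K : ℝ≥0∞} {c : ℝ} {B : Set E3} (hB : MeasurableSet B)
    (h : ∀ σ ∈ Icc 0 c, ∀ y ∈ B, A ≤ K *
      ∫⁻ u in Ioc (0 : ℝ) 1, ENNReal.ofReal (u ^ 6) * q (u ^ 2 * σ, squash e (u ^ 2) y)) :
    A * (ENNReal.ofReal c * volume B) ≤ K * ∫⁻ σ, ∫⁻ y, q (σ, y) := by
  have key := average_le he (hq.const_mul K) (A := A) (c := c) hB fun σ hσ y hy => by
    refine (h σ hσ y hy).trans (le_of_eq ?_)
    have hm : Measurable fun u : ℝ =>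
        ENNReal.ofReal (u ^ 6) * q (u ^ 2 * σ, squash e (u ^ 2) y) := by
      have h1 : Measurable fun u : ℝ => squash e (u ^ 2) y :=
        (measurable_squash e).comp ((measurable_id.pow_const 2).prodMk measurable_const)
      exact (measurable_id.pow_const 6).ennreal_ofReal.mul
        (hq.comp (((measurable_id.pow_const 2).mul_const σ).prodMk h1))
    rw [← lintegral_const_mul _ hm]
    refine lintegral_congr fun u => by ring
  refine key.trans (le_of_eq ?_)
  have hI : Measurable fun σ : ℝ => ∫⁻ y, q (σ, y) := hq.lintegral_prod_right'
  rw [← lintegral_const_mul _ hI]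
  refine lintegral_congr fun σ => ?_
  exact lintegral_const_mul _ (hq.comp measurable_prodMk_left)

theorem lintegral_lintegral_time_le {q H : SpaceTime → ℝ≥0∞} (hH : Measurable H) {L t : ℝ}
    (ht : 0 < t) {K : ℝ} (hK : 0 ≤ K)
    (h : ∀ σ, ENNReal.ofReal L * ∫⁻ y, q (σ, y) ≤ ENNReal.ofReal K * ∫⁻ y, H ((1 - σ) * t, y)) :
    ENNReal.ofReal L * ∫⁻ σ, ∫⁻ y, q (σ, y) ≤
      ENNReal.ofReal (K * t⁻¹) * ∫⁻ s, ∫⁻ y, H (s, y) := by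
  have hI : Measurable fun σ : ℝ => ∫⁻ y, H (σ, y) := hH.lintegral_prod_right'
  rw [← lintegral_const_mul' _ _ ENNReal.ofReal_ne_top]
  refine (lintegral_mono h).trans (le_of_eq ?_)
  rw [lintegral_const_mul' _ _ ENNReal.ofReal_ne_top, lintegral_time hI ht, ← mul_assoc,
    ← ENNReal.ofReal_mul hK]

theorem mul_lintegral_indicator_le {I : Set ℝ} {B : Set E3} (hB : MeasurableSet B)
    {F : SpaceTime → ℝ≥0∞} {a b : ℝ≥0∞} (ha : a ≠ ⊤) {σ : ℝ}
    (h : σ ∈ I → ∫⁻ y in B, a * F (σ, y) ≤ b) :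
    a * ∫⁻ y, (I ×ˢ B).indicator F (σ, y) ≤ b := by
  by_cases hσ : σ ∈ I
  · refine le_trans (le_of_eq ?_) (h hσ)
    rw [lintegral_const_mul' _ _ ha, ← lintegral_indicator hB]
    congr 1
    refine lintegral_congr fun y => ?_
    by_cases hy : y ∈ B
    · rw [indicator_of_mem hy, indicator_of_mem (mk_mem_prod hσ hy)]
    · rw [indicator_of_notMem hy, indicator_of_notMem fun h => hy h.2]
  · have e : ∀ y, (I ×ˢ B).indicator F (σ, y) = 0 := fun y =>
      indicator_of_notMem (fun h => hσ h.1) _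
    simp [e]

/-- The constant of the local estimates. -/
def localConst (C : ℝ) : ℝ := pathConst * segConst C * 16 * 32 ^ 5

theorem pathConst_nonneg : 0 ≤ pathConst := sq_nonneg _

theorem segConst_nonneg {C : ℝ} (hC : 0 ≤ C) : 0 ≤ segConst C := by unfold segConst; linarith

theorem localConst_nonneg {C : ℝ} (hC : 0 ≤ C) : 0 ≤ localConst C := by
  have := pathConst_nonneg
  have := segConst_nonneg hC
  unfold localConst
  positivity

theorem mul_le_of_mul_le {l A Q X : ℝ≥0∞} {P K : ℝ} (hP : 0 ≤ P) (h1 : A ≤ ENNReal.ofReal P * Q)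
    (h2 : l * Q ≤ ENNReal.ofReal K * X) : l * A ≤ ENNReal.ofReal (P * K) * X :=
  calc l * A ≤ l * (ENNReal.ofReal P * Q) := mul_le_mul_right h1 l
    _ = ENNReal.ofReal P * (l * Q) := mul_left_comm _ _ _
    _ ≤ ENNReal.ofReal P * (ENNReal.ofReal K * X) := mul_le_mul_right h2 _
    _ = ENNReal.ofReal (P * K) * X := by rw [← mul_assoc, ← ENNReal.ofReal_mul hP]

/-- Division by the volume of the parameter set, with the volume of a ball bounded below by the cube
of its radius. -/
theorem le_of_average_le {A X : ℝ≥0∞} {L r b B : ℝ} (hL : 0 < L) (hr : 0 < r)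
    (h : ENNReal.ofReal L * (A * (ENNReal.ofReal (1 / 32) *
      volume (Metric.closedBall (0 : E3) (r / 32)))) ≤ ENNReal.ofReal b * X)
    (hB : b * 32 ^ 4 / (L * r ^ 3) ≤ B) : A ≤ ENNReal.ofReal B * X := by
  set a := L * (1 / 32) * (r / 32) ^ 3 with ha
  have ha0 : 0 < a := by positivity
  have h1 : ENNReal.ofReal a * A ≤ ENNReal.ofReal b * X := by
    refine le_trans ?_ h
    rw [EuclideanSpace.volume_closedBall_fin_three, ha, ENNReal.ofReal_mul (by positivity),
      ENNReal.ofReal_mul (by positivity), ENNReal.ofReal_pow (by positivity)]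
    have hpi : (1 : ℝ≥0∞) ≤ ENNReal.ofReal (Real.pi * 4 / 3) := by
      rw [ENNReal.one_le_ofReal]
      linarith [Real.pi_gt_three]
    calc _ = ENNReal.ofReal L * (A * (ENNReal.ofReal (1 / 32) *
          (ENNReal.ofReal (r / 32) ^ 3 * 1))) := by ring
      _ ≤ _ := by gcongr
  have h2 : A ≤ ENNReal.ofReal a⁻¹ * (ENNReal.ofReal b * X) := by
    refine le_trans (le_of_eq ?_) (mul_le_mul_right h1 _)
    rw [← mul_assoc, ← ENNReal.ofReal_mul (by positivity), inv_mul_cancel₀ ha0.ne',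
      ENNReal.ofReal_one, one_mul]
  refine h2.trans ?_
  rw [← mul_assoc, ← ENNReal.ofReal_mul (by positivity)]
  refine mul_le_mul_left (ENNReal.ofReal_le_ofReal (le_trans (le_of_eq ?_) hB)) _
  rw [ha]
  field_simp

/-! ### Pointwise bounds by the density on a ball or a shell -/

section LocalEstimates

variable {w : SpaceTime → ℝ} {E : Set SpaceTime}

/-- Near the axis the radial direction degenerates, so an arbitrary fixed unit vector `e` replaces
it. Scaling and the translations orthogonal to `e` carry the curves. -/
theorem Smooth.sq_dirD_le_of_ball (hw : Smooth w) (hEm : MeasurableSet E) (hEf : E ⊆ future)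
    {κ C : ℝ} (hC : 0 ≤ C) {v : SpaceTime} (hv : ‖v‖ ≤ 1) {t : ℝ} (ht : 0 < t) {x e : E3}
    (he : ‖e‖ = 1)
    (hE : ∀ t' ∈ Icc (31 / 32 * t) t, ∀ x' : E3, ‖x'‖ ≤ ‖x‖ + 1 / 16 → (t', x') ∈ E)
    (hb : ∀ p ∈ E, HessBound (1 / 32) κ C w (0, e) p) :
    ENNReal.ofReal (WaveDecay.dirD v w (t, x) ^ 2) ≤
      ENNReal.ofReal (localConst C / t) * ∫⁻ s, ∫⁻ y, density E κ w (s, y) := by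
  have hH := hw.measurable_density hEm hEf κ
  have hseg := segConst_nonneg hC
  set B := Metric.closedBall (0 : E3) (1 / 32) with hBdef
  have hB : MeasurableSet B := Metric.isClosed_closedBall.measurableSet
  set S : Set SpaceTime := Icc (0 : ℝ) (1 / 32) ×ˢ B
  set z : SpaceTime → SpaceTime := fun z =>
    (1 - z.1) • ((t, x + (z.2 - ⟪e, z.2⟫ • e)) : SpaceTime) with hzdef
  have hzc : Continuous z := by fun_prop
  have hproj : ∀ y : E3, ‖y - ⟪e, y⟫ • e‖ ≤ ‖y‖ := by
    intro y
    refine abs_le_of_sq_le_sq' ?_ (norm_nonneg y) |>.2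
    rw [norm_sub_sq_real, inner_smul_right, norm_smul, he, real_inner_comm e y, mul_one,
      Real.norm_eq_abs, sq_abs]
    nlinarith [sq_nonneg ⟪e, y⟫]
  have hzE : ∀ p ∈ S, ∀ ρ ∈ Icc (0 : ℝ) (1 / 32), z p + ρ • ((0, e) : SpaceTime) ∈ E := by
    rintro ⟨σ, y⟩ ⟨hσ, hy⟩ ρ hρ
    have hy' : ‖y‖ ≤ 1 / 32 := by simpa [hBdef] using hy
    simp only [hzdef, Prod.smul_mk, Prod.mk_add_mk, smul_eq_mul]
    simp only [mem_Icc] at hσ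
    refine hE _ ⟨?_, ?_⟩ _ ?_
    · nlinarith
    · nlinarith
    · refine (norm_add_le _ _).trans ?_
      rw [norm_smul, norm_smul, he, mul_one, Real.norm_eq_abs, Real.norm_eq_abs,
        abs_of_nonneg hρ.1, abs_of_nonneg (by linarith : 0 ≤ 1 - σ)]
      have h1 := norm_add_le x (y - ⟪e, y⟫ • e)
      have h2 := hproj y
      have h3 := norm_nonneg (x + (y - ⟪e, y⟫ • e))
      nlinarith [hρ.2]
  have hzf : MapsTo z S future := fun p hp => by
    have := hEf (hzE p hp 0 ⟨le_rfl, by norm_num⟩)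
    rwa [zero_smul, add_zero] at this
  set q : SpaceTime → ℝ≥0∞ := S.indicator fun p => ENNReal.ofReal (energy w (z p)) with hq
  have hqm : Measurable q := measurable_indicator_ofReal (measurableSet_Icc.prod hB)
    (hw.energy_continuousOn.comp hzc.continuousOn hzf)
  have havg := average_le_of_const he hqm (A := ENNReal.ofReal (WaveDecay.dirD v w (t, x) ^ 2))
    (K := ENNReal.ofReal pathConst) (c := 1 / 32) hB fun σ hσ y hy => by
      have hy' : ‖y‖ ≤ 1 / 32 := by simpa [hBdef] using hy
      refine (hw.sq_dirD_le_translation hv ht ⟨hσ.1, hσ.2.trans (by norm_num)⟩ x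
        (ξ := y - ⟪e, y⟫ • e) ((hproj y).trans (by linarith))).trans ?_
      refine mul_le_mul_right (setLIntegral_mono' measurableSet_Ioc fun u hu => ?_) _
      have hu2 : u ^ 2 ∈ Icc (0 : ℝ) 1 := ⟨sq_nonneg u, pow_le_one₀ hu.1.le hu.2⟩
      have hmem : (u ^ 2 * σ, squash e (u ^ 2) y) ∈ S := by
        refine ⟨⟨mul_nonneg hu2.1 hσ.1, ?_⟩, ?_⟩
        · nlinarith [hu2.1, hu2.2, hσ.1, hσ.2]
        · simpa [hBdef] using (norm_squash_le he hu2 y).trans hy'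
      rw [hq, indicator_of_mem hmem, ENNReal.ofReal_mul (pow_nonneg hu.1.le 6)]
      refine le_of_eq ?_
      congr 4
      simp only [squash_apply, inner_add_right, inner_smul_right, real_inner_self_eq_norm_sq, he]
      congr 1
      simp only [smul_sub, sub_smul, add_smul, mul_smul, one_smul, mul_one, one_pow]
      abel
  have hlow := lintegral_lintegral_time_le (q := q) hH (L := 1 / 32) ht
    (K := segConst C * 16) (by positivity) fun σ => by
      refine mul_lintegral_indicator_le hB ENNReal.ofReal_ne_top fun hσ => ?_
      have hH' : Measurable fun y : E3 => density E κ w ((1 - σ) * t, y) :=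
        hH.comp measurable_prodMk_left
      have h1 := lintegral_translation hH' (m := 1 - σ)
        ⟨by linarith [hσ.2], by linarith [hσ.1]⟩ x he
      rw [ENNReal.ofReal_mul hseg, mul_assoc]
      refine le_trans ?_ (mul_le_mul_right h1 _)
      rw [← lintegral_const_mul' _ _ ENNReal.ofReal_ne_top]
      refine setLIntegral_mono' hB fun y hy => ?_
      refine (hw.energy_le_segment hEf (by norm_num) hC (hzE (σ, y) ⟨hσ, hy⟩)
        fun ρ hρ => hb _ (hzE (σ, y) ⟨hσ, hy⟩ ρ hρ)).trans (le_of_eq ?_)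
      simp [hzdef]
  refine le_of_average_le (r := 1) (by norm_num) one_pos
    (mul_le_of_mul_le pathConst_nonneg havg hlow) (le_of_eq ?_)
  unfold localConst
  field_simp

/-- Scaling and rotations carry the curves, and the segments run inwards along rays. Moving inwards
can only increase `t - r`, which keeps the segments inside the cone `r ≤ t + 2`. -/
theorem Smooth.sq_dirD_le_of_shell (hw : Smooth w) (hEm : MeasurableSet E) (hEf : E ⊆ future)
    {κ C L : ℝ} (hC : 0 ≤ C) {v : SpaceTime} (hv : ‖v‖ ≤ 1) {t : ℝ} (ht : 0 < t) {x : E3}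
    (hx : x ≠ 0) (hL : 0 < L) (hLx : L ≤ ‖x‖ / 4)
    (hE : ∀ σ ∈ Icc (0 : ℝ) (1 / 32), ∀ ρ ∈ Icc 0 L, ∀ x' : E3, ‖x'‖ = (1 - σ) * ‖x‖ - ρ →
      ((1 - σ) * t, x') ∈ E)
    (hb : ∀ p ∈ E, p.2 ≠ 0 → HessBound L κ C w (0, ‖p.2‖⁻¹ • p.2) p) :
    ENNReal.ofReal (WaveDecay.dirD v w (t, x) ^ 2) ≤
      ENNReal.ofReal (localConst C / (t * ‖x‖ ^ 2 * L)) *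
        ∫⁻ s, ∫⁻ y, density E κ w (s, y) := by
  have hr : 0 < ‖x‖ := norm_pos_iff.2 hx
  have hH := hw.measurable_density hEm hEf κ
  have hseg := segConst_nonneg hC
  set e : E3 := ‖x‖⁻¹ • x with hedef
  have he : ‖e‖ = 1 := by
    rw [hedef, norm_smul, norm_inv, norm_norm, inv_mul_cancel₀ hr.ne']
  set B := Metric.closedBall (0 : E3) (‖x‖ / 32) with hBdef
  have hB : MeasurableSet B := Metric.isClosed_closedBall.measurableSet
  have hBn : ∀ y ∈ B, 0 < ‖x + y‖ := by
    intro y hy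
    have hy' : ‖y‖ ≤ ‖x‖ / 32 := by simpa [hBdef] using hy
    have := norm_sub_le (x + y) y
    rw [add_sub_cancel_right] at this
    linarith
  set S : Set SpaceTime := Icc (0 : ℝ) (1 / 32) ×ˢ B
  set z : SpaceTime → SpaceTime := fun z =>
    (1 - z.1) • ((t, (‖x‖ / ‖x + z.2‖) • (x + z.2)) : SpaceTime) with hzdef
  have hzc : ContinuousOn z S := by
    have h0 : Continuous fun z : SpaceTime => x + z.2 := by fun_prop
    have h1 : ContinuousOn (fun z : SpaceTime => ‖x‖ / ‖x + z.2‖) S :=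
      continuousOn_const.div h0.norm.continuousOn fun p hp => (hBn _ hp.2).ne'
    exact (continuous_const.sub continuous_fst).continuousOn.smul
      (continuousOn_const.prodMk (h1.smul h0.continuousOn))
  have hline : ∀ σ : ℝ, ∀ y ∈ B, ∀ ρ : ℝ,
      z (σ, y) + ρ • ((-(0, ‖x + y‖⁻¹ • (x + y)) : SpaceTime)) =
        ((1 - σ) * t, (((1 - σ) * ‖x‖ - ρ) / ‖x + y‖) • (x + y)) := by
    intro σ y hy ρ
    have hn := (hBn y hy).ne'
    refine Prod.ext (by simp [hzdef]) ?_
    simp only [hzdef, Prod.smul_mk, Prod.neg_mk, Prod.mk_add_mk, smul_smul, smul_neg,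
      ← sub_eq_add_neg, ← sub_smul]
    congr 1
    field_simp
  have hpos : ∀ σ ∈ Icc (0 : ℝ) (1 / 32), ∀ ρ ∈ Icc 0 L, 0 < (1 - σ) * ‖x‖ - ρ := by
    intro σ hσ ρ hρ
    nlinarith [hσ.2, hρ.2]
  have hzE : ∀ σ ∈ Icc (0 : ℝ) (1 / 32), ∀ y ∈ B, ∀ ρ ∈ Icc 0 L,
      z (σ, y) + ρ • ((-(0, ‖x + y‖⁻¹ • (x + y)) : SpaceTime)) ∈ E := by
    intro σ hσ y hy ρ hρ
    rw [hline σ y hy ρ]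
    refine hE σ hσ ρ hρ _ ?_
    rw [norm_smul, Real.norm_eq_abs, abs_of_pos (div_pos (hpos σ hσ ρ hρ) (hBn y hy)),
      div_mul_cancel₀ _ (hBn y hy).ne']
  have hzH : ∀ σ ∈ Icc (0 : ℝ) (1 / 32), ∀ y ∈ B, ∀ ρ ∈ Icc 0 L,
      HessBound L κ C w (-(0, ‖x + y‖⁻¹ • (x + y)))
        (z (σ, y) + ρ • ((-(0, ‖x + y‖⁻¹ • (x + y)) : SpaceTime))) := by
    intro σ hσ y hy ρ hρ
    have hmem := hzE σ hσ y hy ρ hρ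
    have hl := div_pos (hpos σ hσ ρ hρ) (hBn y hy)
    rw [hline σ y hy ρ] at hmem ⊢
    have h2 := hb _ hmem (smul_ne_zero hl.ne' (norm_pos_iff.1 (hBn y hy)))
    refine HessBound.neg ?_
    have e2 : ‖(((1 - σ) * ‖x‖ - ρ) / ‖x + y‖) • (x + y)‖⁻¹ •
        ((((1 - σ) * ‖x‖ - ρ) / ‖x + y‖) • (x + y)) = ‖x + y‖⁻¹ • (x + y) := by
      rw [norm_smul, Real.norm_eq_abs, abs_of_pos hl, smul_smul]
      congr 1
      have h3 := (hBn y hy).ne'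
      have h4 := (hpos σ hσ ρ hρ).ne'
      field_simp
    simp only [e2] at h2
    exact h2
  have hzf : MapsTo z S future := fun p hp => by
    have := hEf (hzE p.1 hp.1 p.2 hp.2 0 ⟨le_rfl, hL.le⟩)
    rwa [zero_smul, add_zero] at this
  set q : SpaceTime → ℝ≥0∞ := S.indicator fun p => ENNReal.ofReal (energy w (z p)) with hq
  have hqm : Measurable q := measurable_indicator_ofReal (measurableSet_Icc.prod hB)
    (hw.energy_continuousOn.comp hzc hzf)
  have havg := average_le_of_const he hqm (A := ENNReal.ofReal (WaveDecay.dirD v w (t, x) ^ 2))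
    (K := ENNReal.ofReal pathConst) (c := 1 / 32) hB fun σ hσ y hy => by
      have hy' : ‖y‖ ≤ ‖x‖ / 32 := by simpa [hBdef] using hy
      set b : ℝ := ⟪e, y⟫ with hbdef
      have hb1 : |b| ≤ ‖x‖ / 32 := by
        have h1 := abs_real_inner_le_norm e y
        rw [he, one_mul] at h1
        exact h1.trans hy'
      rw [abs_le] at hb1
      have hβ : 31 / 32 ≤ 1 + b / ‖x‖ := by
        have : -(1 / 32) ≤ b / ‖x‖ := by rw [le_div_iff₀ hr]; linarith
        linarith
      have hβ0 : 0 < 1 + b / ‖x‖ := by linarith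
      -- The radial part `b` of `y` lengthens `x` to `(1 + b/‖x‖) x`. With this normalization, `x +
      -- squash e s y` and `x + sξ` lie on the same ray for every `s`, so the contraction of `y`
      -- follows the rotation curve.
      set ξ : E3 := (1 + b / ‖x‖)⁻¹ • (y - b • e) with hξdef
      have horth : ⟪x, ξ⟫ = 0 := by
        rw [hξdef, inner_smul_right, inner_sub_right, inner_smul_right]
        have hin : ∀ u : E3, ⟪x, u⟫ = ‖x‖ * ⟪e, u⟫ := fun u => by
          rw [hedef, real_inner_smul_left]
          field_simp
        rw [hin, hin, real_inner_self_eq_norm_sq, he, ← hbdef]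
        ring
      have hproj : ‖y - b • e‖ ≤ ‖y‖ := by
        refine abs_le_of_sq_le_sq' ?_ (norm_nonneg y) |>.2
        rw [norm_sub_sq_real, inner_smul_right, norm_smul, he, real_inner_comm e y, ← hbdef,
          mul_one, Real.norm_eq_abs, sq_abs]
        nlinarith [sq_nonneg b]
      have hξ : ‖ξ‖ ≤ ‖x‖ / 2 := by
        rw [hξdef, norm_smul, norm_inv, Real.norm_eq_abs, abs_of_pos hβ0, inv_mul_le_iff₀ hβ0]
        nlinarith
      refine (hw.sq_dirD_le_rotation hv ht ⟨hσ.1, hσ.2.trans (by norm_num)⟩ hx hξ horth).trans ?_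
      refine mul_le_mul_right (setLIntegral_mono' measurableSet_Ioc fun u hu => ?_) _
      have hu2 : u ^ 2 ∈ Icc (0 : ℝ) 1 := ⟨sq_nonneg u, pow_le_one₀ hu.1.le hu.2⟩
      have hmem : (u ^ 2 * σ, squash e (u ^ 2) y) ∈ S := by
        refine ⟨⟨mul_nonneg hu2.1 hσ.1, ?_⟩, ?_⟩
        · nlinarith [hu2.1, hu2.2, hσ.1, hσ.2]
        · simpa [hBdef] using (norm_squash_le he hu2 y).trans hy'
      rw [hq, indicator_of_mem hmem, ENNReal.ofReal_mul (pow_nonneg hu.1.le 6)]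
      refine le_of_eq ?_
      have hsq : x + squash e (u ^ 2) y = (1 + b / ‖x‖) • (x + u ^ 2 • ξ) := by
        rw [hξdef, smul_add, smul_comm (u ^ 2), smul_smul, mul_inv_cancel₀ hβ0.ne', one_smul,
          squash_apply, ← hbdef]
        have : (b / ‖x‖) • x = b • e := by rw [hedef, smul_smul, div_eq_mul_inv]
        rw [add_smul, one_smul, this, smul_sub, sub_mul, sub_smul, one_mul, mul_smul]
        abel
      have hsc : (‖x‖ / ‖x + squash e (u ^ 2) y‖) • (x + squash e (u ^ 2) y) =
          (‖x‖ / ‖x + u ^ 2 • ξ‖) • (x + u ^ 2 • ξ) := by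
        rw [hsq, norm_smul, Real.norm_eq_abs, abs_of_pos hβ0, smul_smul]
        congr 1
        rw [div_mul_eq_mul_div, mul_comm ‖x‖, mul_div_mul_left _ _ hβ0.ne']
      simp only [hzdef, hsc]
  have hlow := lintegral_lintegral_time_le (q := q) hH (L := L) ht
    (K := segConst C * (24 * ‖x‖)) (by positivity) fun σ => by
      refine mul_lintegral_indicator_le hB ENNReal.ofReal_ne_top fun hσ => ?_
      have hH' : Measurable fun y : E3 => density E κ w ((1 - σ) * t, y) :=
        hH.comp measurable_prodMk_left
      have h1 := lintegral_radial hH' (m := 1 - σ)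
        ⟨by linarith [hσ.2], by linarith [hσ.1]⟩ hx hLx
      rw [ENNReal.ofReal_mul hseg, mul_assoc]
      refine le_trans ?_ (mul_le_mul_right h1 _)
      rw [← lintegral_const_mul' _ _ ENNReal.ofReal_ne_top]
      refine setLIntegral_mono' hB fun y hy => ?_
      refine (hw.energy_le_segment hEf hL.le hC (hzE σ hσ y hy) (hzH σ hσ y hy)).trans
        (le_of_eq ?_)
      simp only [hline σ y hy]
  refine le_of_average_le hL hr (mul_le_of_mul_le pathConst_nonneg havg hlow) ?_
  · have hP := mul_nonneg pathConst_nonneg hseg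
    have e1 : pathConst * (segConst C * (24 * ‖x‖) * t⁻¹) * 32 ^ 4 / (L * ‖x‖ ^ 3) =
        (pathConst * segConst C * 24 * 32 ^ 4) / (t * ‖x‖ ^ 2 * L) := by field_simp
    rw [e1]
    refine div_le_div_of_nonneg_right ?_ (by positivity)
    unfold localConst
    linarith

end LocalEstimates

/-! ### Radial second derivatives from `S`, `Ω` and `□` -/

section HessianAlgebra

variable {t r A B : ℝ} {x b : Fin 3 → ℝ} {a : ℝ} {c : Fin 3 → Fin 3 → ℝ}

theorem abs_mul_le_mul {y e r A : ℝ} (hy : |y| ≤ r) (he : |e| ≤ A) : |y * e| ≤ r * A := by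
  rw [abs_mul]
  exact mul_le_mul hy he (abs_nonneg _) ((abs_nonneg _).trans hy)

/-- The scaling and rotation bounds and the wave operator control the second radial derivative. -/
theorem abs_radial_radial_le (ht : 0 < t) (hr : 0 < r) (hx : ∀ i, |x i| ≤ r)
    (hr2 : r ^ 2 = x 0 ^ 2 + x 1 ^ 2 + x 2 ^ 2)
    (hSt : |t * a + ∑ i, x i * b i| ≤ A) (hS : ∀ j, |t * b j + ∑ i, x i * c i j| ≤ A)
    (hR : ∀ i j k, |x i * c j k - x j * c i k| ≤ A) (hB : a - ∑ i, c i i = B) :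
    |(t ^ 2 - r ^ 2) * ∑ j, x j * ∑ i, x i * c i j| ≤
      (r ^ 2 * (t + 3 * r) + 6 * t ^ 2 * r) * A + r ^ 2 * t ^ 2 * |B| := by
  have h1 := abs_mul_le_mul (hx 0) (hR 0 1 1)
  have h2 := abs_mul_le_mul (hx 0) (hR 0 2 2)
  have h3 := abs_mul_le_mul (hx 1) (hR 1 0 0)
  have h4 := abs_mul_le_mul (hx 1) (hR 1 2 2)
  have h5 := abs_mul_le_mul (hx 2) (hR 2 0 0)
  have h6 := abs_mul_le_mul (hx 2) (hR 2 1 1)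
  have s0 := abs_mul_le_mul (hx 0) (hS 0)
  have s1 := abs_mul_le_mul (hx 1) (hS 1)
  have s2 := abs_mul_le_mul (hx 2) (hS 2)
  have s3 : |t * (t * a + ∑ i, x i * b i)| ≤ t * A := abs_mul_le_mul (abs_of_pos ht).le hSt
  simp only [Fin.sum_univ_three] at *
  set e1 := x 0 * (x 0 * c 1 1 - x 1 * c 0 1) + x 0 * (x 0 * c 2 2 - x 2 * c 0 2) +
    x 1 * (x 1 * c 0 0 - x 0 * c 1 0) + x 1 * (x 1 * c 2 2 - x 2 * c 1 2) +
    x 2 * (x 2 * c 0 0 - x 0 * c 2 0) + x 2 * (x 2 * c 1 1 - x 1 * c 2 1) with he1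
  set e3 := t * (t * a + (x 0 * b 0 + x 1 * b 1 + x 2 * b 2)) -
    (x 0 * (t * b 0 + (x 0 * c 0 0 + x 1 * c 1 0 + x 2 * c 2 0)) +
      x 1 * (t * b 1 + (x 0 * c 0 1 + x 1 * c 1 1 + x 2 * c 2 1)) +
      x 2 * (t * b 2 + (x 0 * c 0 2 + x 1 * c 1 2 + x 2 * c 2 2))) with he3
  have b1 : |e1| ≤ 6 * r * A := by
    rw [abs_le] at *
    constructor <;> linarith
  have b3 : |e3| ≤ (t + 3 * r) * A := by
    rw [abs_le] at *
    constructor <;> linarith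
  -- Let `q` be the double radial contraction of the Hessian. The mixed terms cancel in `e3 = t² a -
  -- q`, while `e1 = r² tr c - q`. Eliminating the trace through `a - tr c = B` leaves the factor
  -- `t² - r²` on `q`.
  have key : (t ^ 2 - r ^ 2) * (x 0 * (x 0 * c 0 0 + x 1 * c 1 0 + x 2 * c 2 0) +
      x 1 * (x 0 * c 0 1 + x 1 * c 1 1 + x 2 * c 2 1) +
      x 2 * (x 0 * c 0 2 + x 1 * c 1 2 + x 2 * c 2 2)) =
      r ^ 2 * e3 + (-t ^ 2) * e1 + (-(r ^ 2 * t ^ 2)) * B := by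
    rw [he1, he3, ← hB]
    linear_combination (-t ^ 2 * (c 0 0 + c 1 1 + c 2 2)) * hr2
  rw [key]
  refine (abs_add_three _ _ _).trans ?_
  have k1 : |r ^ 2 * e3| ≤ r ^ 2 * ((t + 3 * r) * A) :=
    abs_mul_le_mul (abs_of_nonneg (sq_nonneg r)).le b3
  have k2 : |-t ^ 2 * e1| ≤ t ^ 2 * (6 * r * A) :=
    abs_mul_le_mul (by rw [abs_neg, abs_of_nonneg (sq_nonneg t)]) b1
  have k3 : |-(r ^ 2 * t ^ 2) * B| = r ^ 2 * t ^ 2 * |B| := by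
    rw [abs_mul, abs_neg, abs_of_nonneg (by positivity)]
  linarith

/-- The vector `∑ i, x i * c i j` has radial part `x j q / r²`, where `q` is the double radial
contraction. By symmetry of `c`, its remaining part consists of rotation terms. -/
theorem abs_radial_le (hr : 0 < r) (hx : ∀ i, |x i| ≤ r)
    (hr2 : r ^ 2 = x 0 ^ 2 + x 1 ^ 2 + x 2 ^ 2) (hc : ∀ i j, c i j = c j i)
    (hR : ∀ i j k, |x i * c j k - x j * c i k| ≤ A) (j : Fin 3) :
    |∑ i, x i * c i j| ≤ |∑ j, x j * ∑ i, x i * c i j| / r + 9 * A := by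
  have hk : ∀ k, |x k * ∑ i, x i * (x k * c j i - x j * c k i)| ≤ r * (3 * r * A) := by
    intro k
    refine abs_mul_le_mul (hx k) ?_
    rw [Fin.sum_univ_three]
    have h0 := abs_mul_le_mul (hx 0) (hR k j 0)
    have h1 := abs_mul_le_mul (hx 1) (hR k j 1)
    have h2 := abs_mul_le_mul (hx 2) (hR k j 2)
    refine (abs_add_three _ _ _).trans ?_
    linarith
  have h0 := hk 0
  have h1 := hk 1
  have h2 := hk 2
  have key : r ^ 2 * ∑ i, x i * c i j = x j * (∑ j, x j * ∑ i, x i * c i j) +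
      (x 0 * (∑ i, x i * (x 0 * c j i - x j * c 0 i)) +
        x 1 * (∑ i, x i * (x 1 * c j i - x j * c 1 i)) +
        x 2 * (∑ i, x i * (x 2 * c j i - x j * c 2 i))) := by
    simp only [Fin.sum_univ_three, hr2]
    rw [hc j 0, hc j 1, hc j 2, hc 1 0, hc 2 0, hc 2 1]
    ring
  set q := ∑ j, x j * ∑ i, x i * c i j
  have hq : |x j * q| ≤ r * |q| := abs_mul_le_mul (hx j) le_rfl
  have hsum : r ^ 2 * |∑ i, x i * c i j| ≤ r * |q| + 9 * r ^ 2 * A := by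
    rw [← abs_of_nonneg (sq_nonneg r), ← abs_mul, abs_of_nonneg (sq_nonneg r), key]
    refine (abs_add_le _ _).trans ?_
    have := abs_add_three (x 0 * (∑ i, x i * (x 0 * c j i - x j * c 0 i)))
      (x 1 * (∑ i, x i * (x 1 * c j i - x j * c 1 i)))
      (x 2 * (∑ i, x i * (x 2 * c j i - x j * c 2 i)))
    linarith
  have h3 : r ^ 2 * (|q| / r + 9 * A) = r * |q| + 9 * r ^ 2 * A := by field_simp
  rw [← h3] at hsum
  exact le_of_mul_le_mul_left hsum (by positivity)

end HessianAlgebra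

section HessBounds

variable {f w : SpaceTime → ℝ} {p : SpaceTime}

theorem Smooth.abs_adm_dirD_le_of_gradAbs (hf : Smooth f) (hp : p ∈ future) {G : ℝ}
    (h0 : gradAbs f p ≤ G) (h1 : ∀ j, gradAbs (WaveDecay.adm j f) p ≤ G) {v : SpaceTime}
    (hv : ‖v‖ ≤ 1) (k : Fin 8) :
    |WaveDecay.adm k (WaveDecay.dirD v f) p| ≤ 8 * linBound * G := by
  rw [hf.adm_dirD k v hp]
  have hM := one_le_linBound
  have hG : 0 ≤ G := (gradAbs_nonneg f p).trans h0
  have hl : ‖lin k v‖ ≤ linBound := (norm_lin_le k v).trans (by nlinarith [norm_nonneg v])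
  have b1 := abs_dirD_le v (WaveDecay.adm k f) p
  have b2 := abs_dirD_le (lin k v) f p
  have b3 : ‖v‖ * gradAbs (WaveDecay.adm k f) p ≤ linBound * G :=
    mul_le_mul (hv.trans hM) (h1 k) (gradAbs_nonneg _ _) (by linarith)
  have b4 : ‖lin k v‖ * gradAbs f p ≤ linBound * G :=
    mul_le_mul hl h0 (gradAbs_nonneg _ _) (by linarith)
  refine (abs_sub _ _).trans ?_
  linarith

theorem norm_timeDir : ‖((1, 0) : SpaceTime)‖ ≤ 1 := by
  rw [Prod.norm_def]
  simp

theorem norm_spaceDir (i : Fin 3) : ‖((0, EuclideanSpace.single i 1) : SpaceTime)‖ ≤ 1 := by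
  rw [Prod.norm_def]
  simp

theorem HessBound.of_forall {L κ C : ℝ} {θ : SpaceTime}
    (h : ∀ f B, Smooth f → gradAbs f p ≤ gradZ 3 w p →
      (∀ j, gradAbs (adm j f) p ≤ gradZ 3 w p) → |box f p| ≤ B → B = boxZ 2 w p →
      L * |dirD θ (dt f) p| ≤ C * (gradZ 3 w p + κ * B) ∧
      ∀ i, L * |dirD θ (dx i f) p| ≤ C * (gradZ 3 w p + κ * B)) (hw : Smooth w) :
    HessBound L κ C w θ p := by
  intro k hk μ
  refine h (admWord μ w) (boxZ 2 w p) (hw.admWord μ) (gradAbs_admWord_le w p (by omega) μ)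
    (fun j => ?_) (abs_box_admWord_le w p hk μ) rfl
  rw [← admWord_cons]
  exact gradAbs_admWord_le w p (by omega) _

/-- The constant of the Hessian bounds. -/
def hessConst : ℝ := 160 * linBound

theorem hessConst_nonneg : 0 ≤ hessConst := by
  have := one_le_linBound
  unfold hessConst
  linarith

/-- For `L ≤ 1` no gain is needed, and the partial derivatives are themselves admissible. This
covers the axis and the neighbourhood of the light cone, where `t² - r²` may vanish. -/
theorem Smooth.hessBound_of_le_one (hw : Smooth w) (hp : p ∈ future) {L κ : ℝ}
    (hL : L ∈ Icc (0 : ℝ) 1) (hκ : 0 ≤ κ) {e : E3} (he : ‖e‖ ≤ 1) :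
    HessBound L κ hessConst w (0, e) p := by
  refine HessBound.of_forall (fun f B hf h0 h1 hB _ => ?_) hw
  set G := gradZ 3 w p
  have hG : 0 ≤ G := gradZ_nonneg _ _ _
  have hB0 : 0 ≤ κ * B := mul_nonneg hκ ((abs_nonneg _).trans hB)
  have hM := one_le_linBound
  have key : ∀ v : SpaceTime, ‖v‖ ≤ 1 →
      L * |WaveDecay.dirD (0, e) (WaveDecay.dirD v f) p| ≤ hessConst * (G + κ * B) := by
    intro v hv
    have hj := hf.abs_adm_dirD_le_of_gradAbs hp h0 h1 hv
    have hi : ∀ i, |e i| ≤ 1 := fun i => (abs_apply_le_norm e i).trans he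
    have k0 : |e 0 * WaveDecay.dx 0 (WaveDecay.dirD v f) p| ≤ 1 * (8 * linBound * G) :=
      abs_mul_le_mul (hi 0) (hj 1)
    have k1 : |e 1 * WaveDecay.dx 1 (WaveDecay.dirD v f) p| ≤ 1 * (8 * linBound * G) :=
      abs_mul_le_mul (hi 1) (hj 2)
    have k2 : |e 2 * WaveDecay.dx 2 (WaveDecay.dirD v f) p| ≤ 1 * (8 * linBound * G) :=
      abs_mul_le_mul (hi 2) (hj 3)
    have hb : |WaveDecay.dirD (0, e) (WaveDecay.dirD v f) p| ≤ 24 * linBound * G := by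
      rw [dirD_eq, Fin.sum_univ_three]
      simp only [zero_mul, zero_add]
      refine (abs_add_three _ _ _).trans ?_
      linarith
    refine (mul_le_of_le_one_left (abs_nonneg _) hL.2).trans (hb.trans ?_)
    unfold hessConst
    have := mul_nonneg (by linarith : 0 ≤ linBound) hG
    have := mul_nonneg (by linarith : 0 ≤ linBound) hB0
    linarith
  exact ⟨key _ norm_timeDir, fun i => key _ (norm_spaceDir i)⟩

/-- The last two hypotheses say that dividing by `t² - r²` loses no more than `L` gains: `h1` serves
the terms with `S` and `Ω`, and `h2` the term with `□`. -/
theorem Smooth.hessBound_of_timelike (hw : Smooth w) (hp : p ∈ future) {L κ : ℝ} (hL : 0 ≤ L)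
    (hκ : 0 ≤ κ) (hx : p.2 ≠ 0) (hrt : ‖p.2‖ < p.1) (hLr : L ≤ ‖p.2‖)
    (h1 : L * p.1 ^ 2 ≤ ‖p.2‖ * (p.1 ^ 2 - ‖p.2‖ ^ 2))
    (h2 : L * p.1 ^ 2 ≤ κ * (p.1 ^ 2 - ‖p.2‖ ^ 2)) :
    HessBound L κ hessConst w (0, ‖p.2‖⁻¹ • p.2) p := by
  refine HessBound.of_forall (fun f B hf hf0 hf1 hB _ => ?_) hw
  set G := gradZ 3 w p
  set t := p.1
  set r := ‖p.2‖ with hrdef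
  have hr : 0 < r := norm_pos_iff.2 hx
  have ht : 0 < t := hp
  have hG : 0 ≤ G := gradZ_nonneg _ _ _
  have hM := one_le_linBound
  set A := 8 * linBound * G with hA
  have hA0 : 0 ≤ A := by positivity
  have hB0 : 0 ≤ B := (abs_nonneg _).trans hB
  set a := WaveDecay.dt (WaveDecay.dt f) p
  set b : Fin 3 → ℝ := fun i => WaveDecay.dx i (WaveDecay.dt f) p with hb
  set c : Fin 3 → Fin 3 → ℝ := fun i j => WaveDecay.dx i (WaveDecay.dx j f) p with hc
  have hxi : ∀ i, |p.2 i| ≤ r := abs_apply_le_norm p.2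
  have hr2 : r ^ 2 = p.2 0 ^ 2 + p.2 1 ^ 2 + p.2 2 ^ 2 := norm_sq_eq_sum p.2
  have hZt := hf.abs_adm_dirD_le_of_gradAbs hp hf0 hf1 norm_timeDir
  have hZx := fun i => hf.abs_adm_dirD_le_of_gradAbs hp hf0 hf1 (norm_spaceDir i)
  -- In the numbering of `adm`, index 7 is the scaling field and 4, 5, 6 are the rotations.
  have hSt : |t * a + ∑ i, p.2 i * b i| ≤ A := hZt 7
  have hS : ∀ j, |t * b j + ∑ i, p.2 i * c i j| ≤ A := fun j => by
    have e : b j = WaveDecay.dt (WaveDecay.dx j f) p := hf.dirD_comm _ _ hp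
    rw [e]
    exact hZx j 7
  have hcs : ∀ i j, c i j = c j i := fun i j => hf.dirD_comm _ _ hp
  have hR : ∀ i j k, |p.2 i * c j k - p.2 j * c i k| ≤ A := by
    have hr0 : ∀ k, |p.2 1 * c 2 k - p.2 2 * c 1 k| ≤ A := fun k => hZx k 4
    have hr1 : ∀ k, |p.2 2 * c 0 k - p.2 0 * c 2 k| ≤ A := fun k => hZx k 5
    have hr2 : ∀ k, |p.2 0 * c 1 k - p.2 1 * c 0 k| ≤ A := fun k => hZx k 6
    intro i j k
    fin_cases i <;> fin_cases j
    · simpa using hA0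
    · exact hr2 k
    · rw [abs_sub_comm]; exact hr1 k
    · rw [abs_sub_comm]; exact hr2 k
    · simpa using hA0
    · exact hr0 k
    · exact hr1 k
    · rw [abs_sub_comm]; exact hr0 k
    · simpa using hA0
  have hrr := abs_radial_radial_le ht hr hxi hr2 hSt hS hR (B := WaveDecay.box f p) rfl
  have hrad := abs_radial_le hr hxi hr2 hcs hR
  set q := ∑ j, p.2 j * ∑ i, p.2 i * c i j with hq
  have hD : 0 < t ^ 2 - r ^ 2 := by nlinarith
  rw [abs_mul, abs_of_pos hD] at hrr
  have hLq : L * |q| ≤ r ^ 2 * (10 * A + κ * B) := by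
    refine le_of_mul_le_mul_left ?_ hD
    have e1 : r ^ 2 * (t + 3 * r) + 6 * t ^ 2 * r ≤ 10 * (r * t ^ 2) := by
      have e3 : r * t + 3 * r ^ 2 + 6 * t ^ 2 ≤ 10 * t ^ 2 := by nlinarith
      have := mul_le_mul_of_nonneg_left e3 hr.le
      linarith
    have e2 : (t ^ 2 - r ^ 2) * |q| ≤ 10 * (r * t ^ 2) * A + r ^ 2 * t ^ 2 * B :=
      hrr.trans (add_le_add (mul_le_mul_of_nonneg_right e1 hA0)
        (mul_le_mul_of_nonneg_left hB (by positivity)))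
    calc (t ^ 2 - r ^ 2) * (L * |q|) = L * ((t ^ 2 - r ^ 2) * |q|) := by ring
      _ ≤ L * (10 * (r * t ^ 2) * A + r ^ 2 * t ^ 2 * B) := mul_le_mul_of_nonneg_left e2 hL
      _ = 10 * r * A * (L * t ^ 2) + r ^ 2 * B * (L * t ^ 2) := by ring
      _ ≤ 10 * r * A * (r * (t ^ 2 - r ^ 2)) + r ^ 2 * B * (κ * (t ^ 2 - r ^ 2)) :=
          add_le_add (mul_le_mul_of_nonneg_left h1 (by positivity))
            (mul_le_mul_of_nonneg_left h2 (by positivity))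
      _ = (t ^ 2 - r ^ 2) * (r ^ 2 * (10 * A + κ * B)) := by ring
  have hfin : 20 * A + κ * B ≤ hessConst * (G + κ * B) := by
    have : κ * B ≤ hessConst * (κ * B) := by
      refine le_mul_of_one_le_left (mul_nonneg hκ hB0) ?_
      unfold hessConst
      linarith
    rw [mul_add]
    have e : hessConst * G = 20 * A := by rw [hA]; unfold hessConst; ring
    linarith
  have hdir : ∀ g, WaveDecay.dirD (0, r⁻¹ • p.2) g p = (∑ i, p.2 i * WaveDecay.dx i g p) / r := by
    intro g
    rw [dirD_eq, Fin.sum_univ_three, Fin.sum_univ_three]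
    simp
    field_simp
  refine ⟨?_, fun j => ?_⟩
  · refine le_trans ?_ hfin
    rw [hdir, abs_div, abs_of_pos hr]
    change L * (|∑ i, p.2 i * b i| / r) ≤ _
    have s0 := abs_mul_le_mul (hxi 0) (hS 0)
    have s1 := abs_mul_le_mul (hxi 1) (hS 1)
    have s2 := abs_mul_le_mul (hxi 2) (hS 2)
    have hsum : t * |∑ i, p.2 i * b i| ≤ |q| + 3 * r * A := by
      -- The time component reduces to `q` by contracting `S∇f` with `x`.
      have e : t * ∑ i, p.2 i * b i = (p.2 0 * (t * b 0 + ∑ i, p.2 i * c i 0) +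
          p.2 1 * (t * b 1 + ∑ i, p.2 i * c i 1) + p.2 2 * (t * b 2 + ∑ i, p.2 i * c i 2)) - q := by
        simp only [hq, Fin.sum_univ_three]
        ring
      have e2 : t * |∑ i, p.2 i * b i| = |t * ∑ i, p.2 i * b i| := by rw [abs_mul, abs_of_pos ht]
      rw [e2, e]
      refine (abs_sub _ _).trans ?_
      have := abs_add_three (p.2 0 * (t * b 0 + ∑ i, p.2 i * c i 0))
        (p.2 1 * (t * b 1 + ∑ i, p.2 i * c i 1)) (p.2 2 * (t * b 2 + ∑ i, p.2 i * c i 2))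
      linarith
    have h3 : r * (L * |∑ i, p.2 i * b i|) ≤ r * (r * (20 * A + κ * B)) := by
      calc r * (L * |∑ i, p.2 i * b i|) ≤ t * (L * |∑ i, p.2 i * b i|) :=
            mul_le_mul_of_nonneg_right hrt.le (by positivity)
        _ = L * (t * |∑ i, p.2 i * b i|) := by ring
        _ ≤ L * (|q| + 3 * r * A) := mul_le_mul_of_nonneg_left hsum hL
        _ = L * |q| + L * (3 * r * A) := by ring
        _ ≤ r ^ 2 * (10 * A + κ * B) + r * (3 * r * A) :=
            add_le_add hLq (mul_le_mul_of_nonneg_right hLr (by positivity))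
        _ ≤ r * (r * (20 * A + κ * B)) := by nlinarith [mul_nonneg (sq_nonneg r) hA0]
    rw [← mul_div_assoc, div_le_iff₀ hr, mul_comm _ r]
    exact le_of_mul_le_mul_left h3 hr
  · refine le_trans ?_ hfin
    rw [hdir, abs_div, abs_of_pos hr]
    change L * (|∑ i, p.2 i * c i j| / r) ≤ _
    calc L * (|∑ i, p.2 i * c i j| / r) ≤ L * ((|q| / r + 9 * A) / r) := by
          have := hrad j
          gcongr
      _ = L * |q| / r ^ 2 + L / r * (9 * A) := by field_simp
      _ ≤ r ^ 2 * (10 * A + κ * B) / r ^ 2 + 1 * (9 * A) := by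
          gcongr
          rwa [div_le_one hr]
      _ ≤ 20 * A + κ * B := by
          rw [mul_div_cancel_left₀ _ (by positivity : r ^ 2 ≠ 0)]
          linarith

end HessBounds

/-! ### Mixed norms and the integral of the density -/

section MixedNorm

theorem sq_eLpNorm_two {X ε : Type*} [MeasurableSpace X] {μ : Measure X} [TopologicalSpace ε]
    [ContinuousENorm ε] (f : X → ε) : eLpNorm f 2 μ ^ 2 = ∫⁻ x, ‖f x‖ₑ ^ 2 ∂μ := by
  have h := eLpNorm_nnreal_pow_eq_lintegral (μ := μ) (f := f) (p := 2) (by norm_num)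
  simpa using h

theorem sq_mixedNorm_two (D : Set SpaceTime) (u : SpaceTime → ℝ) :
    mixedNorm 2 2 D u ^ 2 = ∫⁻ t in Ici (0 : ℝ), ∫⁻ x, ‖D.indicator u (t, x)‖ₑ ^ 2 := by
  unfold mixedNorm
  rw [sq_eLpNorm_two]
  simp only [enorm_eq_self, sq_eLpNorm_two]

theorem mixedNorm_top_le {D : Set SpaceTime} {u : SpaceTime → ℝ} {M : ℝ≥0∞}
    (h : ∀ p ∈ D, ‖u p‖ₑ ≤ M) : mixedNorm ⊤ ⊤ D u ≤ M := by
  unfold mixedNorm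
  rw [eLpNorm_exponent_top]
  refine eLpNormEssSup_le_of_ae_enorm_bound (Filter.Eventually.of_forall fun t => ?_)
  rw [enorm_eq_self, eLpNorm_exponent_top]
  refine eLpNormEssSup_le_of_ae_enorm_bound (Filter.Eventually.of_forall fun x => ?_)
  by_cases hp : (t, x) ∈ D
  · rw [indicator_of_mem hp]
    exact h _ hp
  · rw [indicator_of_notMem hp]
    simp

variable {w : SpaceTime → ℝ} {E : Set SpaceTime}

theorem enorm_sq_eq_ofReal (a : ℝ) : ‖a‖ₑ ^ 2 = ENNReal.ofReal (a ^ 2) := by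
  rw [← sq_abs, ENNReal.ofReal_pow (abs_nonneg _), Real.enorm_eq_ofReal_abs]

theorem Smooth.lintegral_density (hw : Smooth w) (hEm : MeasurableSet E) (hEf : E ⊆ future)
    (κ : ℝ) : ∫⁻ s, ∫⁻ y, density E κ w (s, y) = mixedNorm 2 2 E (gradZ 3 w) ^ 2 +
      ENNReal.ofReal (κ ^ 2) * mixedNorm 2 2 E (boxZ 2 w) ^ 2 := by
  have hm : ∀ u : SpaceTime → ℝ, ContinuousOn u future →
      Measurable fun p => ‖E.indicator u p‖ₑ ^ 2 := by
    intro u hu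
    have h := measurable_indicator_ofReal hEm ((hu.mono hEf).pow 2)
    have e : (fun p => ‖E.indicator u p‖ₑ ^ 2) =
        E.indicator fun p => ENNReal.ofReal ((u ^ 2) p) := by
      funext p
      by_cases hp : p ∈ E
      · rw [indicator_of_mem hp, indicator_of_mem hp, enorm_sq_eq_ofReal]
        rfl
      · rw [indicator_of_notMem hp, indicator_of_notMem hp]
        simp
    rw [e]
    exact h
  have hg := hm _ (hw.gradZ_continuousOn 3)
  have hb := hm _ (hw.boxZ_continuousOn 2)
  have hpt : ∀ p, density E κ w p = ‖E.indicator (gradZ 3 w) p‖ₑ ^ 2 +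
      ENNReal.ofReal (κ ^ 2) * ‖E.indicator (boxZ 2 w) p‖ₑ ^ 2 := by
    intro p
    unfold density
    by_cases hp : p ∈ E
    · rw [indicator_of_mem hp, indicator_of_mem hp, indicator_of_mem hp, enorm_sq_eq_ofReal,
        enorm_sq_eq_ofReal, ← ENNReal.ofReal_mul (sq_nonneg κ),
        ← ENNReal.ofReal_add (sq_nonneg _) (by positivity)]
      rfl
    · rw [indicator_of_notMem hp, indicator_of_notMem hp, indicator_of_notMem hp]
      simp
  -- The restriction to `t ≥ 0` in the mixed norm is harmless because the density is supported in
  -- `E`, inside the future.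
  have hres : ∫⁻ s, ∫⁻ y, density E κ w (s, y) =
      ∫⁻ s in Ici (0 : ℝ), ∫⁻ y, density E κ w (s, y) := by
    rw [← lintegral_indicator measurableSet_Ici]
    refine lintegral_congr fun s => ?_
    by_cases hs : s ∈ Ici (0 : ℝ)
    · rw [indicator_of_mem hs]
    · rw [indicator_of_notMem hs]
      have h0 : ∀ y, density E κ w (s, y) = 0 := fun y =>
        indicator_of_notMem (fun h => hs (mem_Ici.2 (le_of_lt (hEf h)))) _
      simp [h0]
  rw [hres, sq_mixedNorm_two, sq_mixedNorm_two]
  simp only [hpt]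
  have h1 : ∀ s : ℝ, ∫⁻ y, (‖E.indicator (gradZ 3 w) (s, y)‖ₑ ^ 2 +
      ENNReal.ofReal (κ ^ 2) * ‖E.indicator (boxZ 2 w) (s, y)‖ₑ ^ 2) =
      (∫⁻ y, ‖E.indicator (gradZ 3 w) (s, y)‖ₑ ^ 2) +
        ENNReal.ofReal (κ ^ 2) * ∫⁻ y, ‖E.indicator (boxZ 2 w) (s, y)‖ₑ ^ 2 := by
    intro s
    have hgs : Measurable fun y : E3 => ‖E.indicator (gradZ 3 w) (s, y)‖ₑ ^ 2 :=
      hg.comp measurable_prodMk_left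
    rw [lintegral_add_left hgs, lintegral_const_mul' _ _ ENNReal.ofReal_ne_top]
  simp only [h1]
  have hgI : Measurable fun s : ℝ => ∫⁻ y : E3, ‖E.indicator (gradZ 3 w) (s, y)‖ₑ ^ 2 :=
    hg.lintegral_prod_right'
  rw [lintegral_add_left hgI, lintegral_const_mul' _ _ ENNReal.ofReal_ne_top]

/-- A pointwise bound of `∂w` on `D` by the density on `E` gives the mixed-norm estimate. -/
theorem Smooth.mixedNorm_gradAbs_le (hw : Smooth w) (hEm : MeasurableSet E) (hEf : E ⊆ future)
    {D : Set SpaceTime} {c κ α β : ℝ} {K : ℝ≥0} (hα : 0 ≤ α) (hβ : 0 ≤ β)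
    (hc : 4 * c ≤ K ^ 2 * α ^ 2) (hκ : β ^ 2 = α ^ 2 * κ ^ 2)
    (h : ∀ p ∈ D, ∀ v : SpaceTime, ‖v‖ ≤ 1 → ENNReal.ofReal (WaveDecay.dirD v w p ^ 2) ≤
      ENNReal.ofReal c * ∫⁻ s, ∫⁻ y, density E κ w (s, y)) :
    mixedNorm ⊤ ⊤ D (gradAbs w) ≤ K * (ENNReal.ofReal α * mixedNorm 2 2 E (gradZ 3 w) +
      ENNReal.ofReal β * mixedNorm 2 2 E (boxZ 2 w)) := by
  refine mixedNorm_top_le fun p hp => ?_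
  rw [← ENNReal.pow_le_pow_left_iff (n := 2) two_ne_zero, enorm_sq_eq_ofReal, sq_gradAbs]
  have hden := hw.lintegral_density hEm hEf κ
  set I := ∫⁻ s, ∫⁻ y, density E κ w (s, y)
  set X := mixedNorm 2 2 E (gradZ 3 w)
  set Y := mixedNorm 2 2 E (boxZ 2 w)
  -- The gradient is the sum of squares over four unit directions, whence the factor 4 in `hc`.
  have h0 := h p hp _ norm_timeDir
  have hi := fun i => h p hp _ (norm_spaceDir i)
  calc ENNReal.ofReal (gradSq w p)
      = ENNReal.ofReal (WaveDecay.dt w p ^ 2) + (ENNReal.ofReal (WaveDecay.dx 0 w p ^ 2) +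
          ENNReal.ofReal (WaveDecay.dx 1 w p ^ 2) + ENNReal.ofReal (WaveDecay.dx 2 w p ^ 2)) := by
        unfold gradSq
        rw [Fin.sum_univ_three, ENNReal.ofReal_add (by positivity) (by positivity),
          ENNReal.ofReal_add (by positivity) (by positivity),
          ENNReal.ofReal_add (by positivity) (by positivity)]
    _ ≤ ENNReal.ofReal c * I + (ENNReal.ofReal c * I + ENNReal.ofReal c * I +
          ENNReal.ofReal c * I) :=
        add_le_add h0 (add_le_add (add_le_add (hi 0) (hi 1)) (hi 2))
    _ = ENNReal.ofReal (4 * c) * I := by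
        rw [ENNReal.ofReal_mul (by norm_num)]
        norm_num
        ring
    _ ≤ ENNReal.ofReal (K ^ 2 * α ^ 2) * I := mul_le_mul_left (ENNReal.ofReal_le_ofReal hc) _
    _ = (K * (ENNReal.ofReal α * X)) ^ 2 + (K * (ENNReal.ofReal β * Y)) ^ 2 := by
        have e2 : ENNReal.ofReal (α ^ 2) * ENNReal.ofReal (κ ^ 2) = ENNReal.ofReal β ^ 2 := by
          rw [← ENNReal.ofReal_mul (sq_nonneg _), ← hκ, ENNReal.ofReal_pow hβ]
        rw [hden, ENNReal.ofReal_mul (by positivity), ENNReal.ofReal_pow K.coe_nonneg,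
          ENNReal.ofReal_coe_nnreal, mul_pow, mul_pow (ENNReal.ofReal α), mul_pow (K : ℝ≥0∞),
          mul_pow (ENNReal.ofReal β), ← e2, ENNReal.ofReal_pow hα]
        ring
    _ ≤ (K * (ENNReal.ofReal α * X) + K * (ENNReal.ofReal β * Y)) ^ 2 := by
        rw [add_sq]
        exact add_le_add_left le_self_add _
    _ = _ := by rw [mul_add]

end MixedNorm

/-! ### Choice of scales on each region -/

section Regions

theorem isClosed_cone : IsClosed cone :=
  (isClosed_le continuous_const continuous_fst).inter
    (isClosed_le continuous_snd.norm (continuous_fst.add continuous_const))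

theorem isClosed_stripE (τ : ℝ) : IsClosed (stripE τ) :=
  isClosed_cone.inter ((isClosed_le continuous_const continuous_fst).inter
    (isClosed_le continuous_fst continuous_const))

theorem measurableSet_regRE (τ R : ℝ) : MeasurableSet (regRE τ R) := by
  unfold regRE
  split_ifs
  · exact ((isClosed_stripE τ).inter
      (isClosed_le continuous_snd.norm continuous_const)).measurableSet
  · exact ((isClosed_stripE τ).inter ((isClosed_le continuous_const continuous_snd.norm).inter
      (isClosed_le continuous_snd.norm continuous_const))).measurableSet

theorem measurableSet_regHalfE (τ : ℝ) : MeasurableSet (regHalfE τ) :=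
  ((isClosed_stripE τ).inter ((isClosed_le continuous_const
    (continuous_fst.sub continuous_snd.norm)).inter
      (isClosed_le continuous_const continuous_snd.norm))).measurableSet

theorem measurableSet_regUE (τ U : ℝ) : MeasurableSet (regUE τ U) := by
  have h : Continuous fun p : SpaceTime => p.1 - ‖p.2‖ := continuous_fst.sub continuous_snd.norm
  unfold regUE
  split_ifs
  · exact ((isClosed_stripE τ).inter (isClosed_le h.abs continuous_const)).measurableSet
  · exact ((isClosed_stripE τ).inter ((isClosed_le continuous_const h).inter
      (isClosed_le h continuous_const))).measurableSet

theorem stripE_subset_future {τ : ℝ} (hτ : 1 ≤ τ) : stripE τ ⊆ future := fun p hp => by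
  have h : 7 / 8 * τ ≤ p.1 := hp.2.1
  show 0 < p.1
  linarith

theorem regRE_subset_stripE (τ R : ℝ) : regRE τ R ⊆ stripE τ := by
  unfold regRE
  split_ifs <;> exact inter_subset_left

theorem regUE_subset_stripE (τ U : ℝ) : regUE τ U ⊆ stripE τ := by
  unfold regUE
  split_ifs <;> exact inter_subset_left

theorem sq_rpow_neg_half {x : ℝ} (hx : 0 ≤ x) : (x ^ (-(1 / 2) : ℝ)) ^ 2 = x⁻¹ := by
  rw [← Real.rpow_natCast, ← Real.rpow_mul hx, ← Real.rpow_neg_one]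
  norm_num

theorem sq_rpow_neg_three_half {x : ℝ} (hx : 0 ≤ x) :
    (x ^ (-(3 / 2) : ℝ)) ^ 2 = (x ^ 3)⁻¹ := by
  rw [← Real.rpow_natCast, ← Real.rpow_mul hx, ← Real.rpow_natCast x 3, ← Real.rpow_neg hx]
  norm_num

/-- The constant of the theorem. -/
def mainConst : ℝ≥0 := Real.toNNReal (Real.sqrt (512 * localConst hessConst))

theorem sq_mainConst : (mainConst : ℝ) ^ 2 = 512 * localConst hessConst := by
  have h := localConst_nonneg hessConst_nonneg
  unfold mainConst
  rw [Real.coe_toNNReal _ (Real.sqrt_nonneg _), Real.sq_sqrt (by positivity)]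

variable {w : SpaceTime → ℝ}

/-- The estimate on a union of shells, with radial length scale `L` and spatial scale `κ`. -/
theorem Smooth.mixedNorm_gradAbs_le_of_shell (hw : Smooth w) {D E : Set SpaceTime}
    (hEm : MeasurableSet E) (hEf : E ⊆ future) {τ κ L α β : ℝ} (hτ : 0 < τ) (hκ : 0 < κ)
    (hL : 0 < L) (hα : 0 ≤ α) (hβ : 0 ≤ β) (hLκ : L ≤ κ / 8)
    (hαL : α ^ 2 = (32 * (τ * κ ^ 2 * L))⁻¹) (hβα : β ^ 2 = α ^ 2 * κ ^ 2)
    (hD : ∀ p ∈ D, τ ≤ p.1 ∧ κ / 2 ≤ ‖p.2‖)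
    (hDE : ∀ p ∈ D, ∀ σ ∈ Icc (0 : ℝ) (1 / 32), ∀ ρ ∈ Icc 0 L, ∀ x : E3,
      ‖x‖ = (1 - σ) * ‖p.2‖ - ρ → ((1 - σ) * p.1, x) ∈ E)
    (hb : ∀ p ∈ E, p.2 ≠ 0 → HessBound L κ hessConst w (0, ‖p.2‖⁻¹ • p.2) p) :
    mixedNorm ⊤ ⊤ D (gradAbs w) ≤ mainConst * (ENNReal.ofReal α * mixedNorm 2 2 E (gradZ 3 w) +
      ENNReal.ofReal β * mixedNorm 2 2 E (boxZ 2 w)) := by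
  have hC := localConst_nonneg hessConst_nonneg
  refine hw.mixedNorm_gradAbs_le hEm hEf (c := localConst hessConst / (τ * (κ / 2) ^ 2 * L))
    (κ := κ) hα hβ (le_of_eq ?_) hβα ?_
  · rw [sq_mainConst, hαL]
    field_simp
    ring
  · rintro ⟨t, x⟩ hp v hv
    obtain ⟨ht, hx⟩ := hD _ hp
    simp only at ht hx
    have ht0 : 0 < t := by linarith
    have hx0 : 0 < ‖x‖ := by linarith
    have hE : ∀ σ ∈ Icc (0 : ℝ) (1 / 32), ∀ ρ ∈ Icc 0 L, ∀ x' : E3,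
        ‖x'‖ = (1 - σ) * ‖x‖ - ρ → ((1 - σ) * t, x') ∈ E := hDE (t, x) hp
    have hloc := hw.sq_dirD_le_of_shell hEm hEf hessConst_nonneg hv ht0 (norm_pos_iff.1 hx0) hL
      (by linarith) hE hb
    refine hloc.trans ?_
    refine mul_le_mul_left (ENNReal.ofReal_le_ofReal ?_) _
    refine div_le_div_of_nonneg_left hC (by positivity) ?_
    gcongr

/-- This region contains the axis, so the ball estimate is used, with `κ = 1` and unit-scale
segments. -/
theorem Smooth.estimate_regR_one (hw : Smooth w) {τ : ℝ} (hτ : 2 ≤ τ) :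
    mixedNorm ⊤ ⊤ (regR τ 1) (gradAbs w) ≤ mainConst *
      (ENNReal.ofReal (τ ^ (-(1 / 2) : ℝ) * (1 : ℝ) ^ (-(3 / 2) : ℝ)) *
          mixedNorm 2 2 (regRE τ 1) (gradZ 3 w) +
        ENNReal.ofReal (τ ^ (-(1 / 2) : ℝ) * (1 : ℝ) ^ (-(1 / 2) : ℝ)) *
          mixedNorm 2 2 (regRE τ 1) (boxZ 2 w)) := by
  have hC := localConst_nonneg hessConst_nonneg
  have hEf := (regRE_subset_stripE τ 1).trans (stripE_subset_future (by linarith))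
  have he : ‖(EuclideanSpace.single 0 1 : E3)‖ = 1 := by simp
  refine hw.mixedNorm_gradAbs_le (measurableSet_regRE τ 1) hEf
    (c := localConst hessConst / τ) (κ := 1) (by positivity) (by positivity) ?_ (by simp) ?_
  · rw [sq_mainConst, mul_pow, sq_rpow_neg_half (by linarith)]
    simp only [Real.one_rpow, one_pow, mul_one, ← div_eq_mul_inv]
    rw [← mul_div_assoc]
    gcongr
    norm_num
  · rintro ⟨t, x⟩ hp v hv
    rw [regR, if_pos rfl] at hp
    obtain ⟨⟨⟨_, _⟩, h1, h2⟩, h3⟩ := hp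
    simp only [mem_ofPred_eq] at h1 h2 h3
    refine (hw.sq_dirD_le_of_ball (measurableSet_regRE τ 1) hEf (κ := 1) hessConst_nonneg hv
      (by linarith) he ?_ fun p hp => hw.hessBound_of_le_one (hEf hp) (by norm_num) one_pos.le
        he.le).trans ?_
    · intro t' ht' x' hx'
      rw [regRE, if_pos rfl]
      refine ⟨⟨⟨?_, ?_⟩, ?_, ?_⟩, ?_⟩ <;> simp only [mem_ofPred_eq] <;> linarith [ht'.1, ht'.2]
    · refine mul_le_mul_left (ENNReal.ofReal_le_ofReal ?_) _
      gcongr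

theorem Smooth.estimate_regR (hw : Smooth w) {τ R : ℝ} (hR : 1 < R) (hRτ : R ≤ τ / 4) :
    mixedNorm ⊤ ⊤ (regR τ R) (gradAbs w) ≤ mainConst *
      (ENNReal.ofReal (τ ^ (-(1 / 2) : ℝ) * R ^ (-(3 / 2) : ℝ)) *
          mixedNorm 2 2 (regRE τ R) (gradZ 3 w) +
        ENNReal.ofReal (τ ^ (-(1 / 2) : ℝ) * R ^ (-(1 / 2) : ℝ)) *
          mixedNorm 2 2 (regRE τ R) (boxZ 2 w)) := by
  have hτ : 0 < τ := by linarith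
  have hR0 : 0 < R := by linarith
  have hEf := (regRE_subset_stripE τ R).trans (stripE_subset_future (by linarith))
  refine hw.mixedNorm_gradAbs_le_of_shell (measurableSet_regRE τ R) hEf (L := R / 32) hτ hR0
    (by positivity) (by positivity) (by positivity) (by linarith) ?_ ?_ ?_ ?_ ?_
  · rw [mul_pow, sq_rpow_neg_half hτ.le, sq_rpow_neg_three_half hR0.le]
    field_simp
  · rw [mul_pow, mul_pow, sq_rpow_neg_half hτ.le, sq_rpow_neg_half hR0.le,
      sq_rpow_neg_three_half hR0.le]
    field_simp
  · rintro ⟨t, x⟩ hp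
    rw [regR, if_neg hR.ne'] at hp
    obtain ⟨⟨_, h1, h2⟩, h3, h4⟩ := hp
    simp only at h1 h2 h3 h4 ⊢
    constructor <;> linarith
  · rintro ⟨t, x⟩ hp σ ⟨hσ0, hσ1⟩ ρ ⟨hρ0, hρ1⟩ x' hx'
    rw [regR, if_neg hR.ne'] at hp
    obtain ⟨⟨⟨h5, h6⟩, h1, h2⟩, h3, h4⟩ := hp
    rw [regRE, if_neg hR.ne']
    simp only at h1 h2 h3 h4 h5 h6 hx' ⊢
    refine ⟨⟨⟨?_, ?_⟩, ?_, ?_⟩, ?_, ?_⟩ <;> simp only [hx'] <;> nlinarith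
  · intro p hp hp0
    refine hw.hessBound_of_timelike (hEf hp) (by positivity) hR0.le hp0 ?_ ?_ ?_ ?_
    all_goals
      rw [regRE, if_neg hR.ne'] at hp
      obtain ⟨⟨_, h1, h2⟩, h3, h4⟩ := hp
    · linarith
    · linarith
    all_goals
      -- From `r ≤ (17/8)(τ/4)` and `t ≥ (7/8)τ`. Thus `t² - r²` is comparable to `t²`, and `L` can
      -- be a multiple of `R`.
      have h5 : ‖p.2‖ ≤ 17 / 28 * p.1 := by linarith
      have h6 : p.1 ^ 2 / 2 ≤ p.1 ^ 2 - ‖p.2‖ ^ 2 := by nlinarith [norm_nonneg p.2]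
      have h7 : 0 ≤ p.1 ^ 2 / 2 := by positivity
    · refine le_trans ?_ (mul_le_mul h3 h6 h7 (norm_nonneg _))
      nlinarith
    · refine le_trans ?_ (mul_le_mul_of_nonneg_left h6 hR0.le)
      nlinarith

theorem Smooth.estimate_regHalf (hw : Smooth w) {τ R : ℝ} (hR : 1 ≤ R) (hRτ : R = τ / 2) :
    mixedNorm ⊤ ⊤ (regHalf τ) (gradAbs w) ≤ mainConst *
      (ENNReal.ofReal (τ ^ (-(1 / 2) : ℝ) * R ^ (-(3 / 2) : ℝ)) *
          mixedNorm 2 2 (regHalfE τ) (gradZ 3 w) +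
        ENNReal.ofReal (τ ^ (-(1 / 2) : ℝ) * R ^ (-(1 / 2) : ℝ)) *
          mixedNorm 2 2 (regHalfE τ) (boxZ 2 w)) := by
  have hτ : 0 < τ := by linarith
  have hR0 : 0 < R := by linarith
  have hEf : regHalfE τ ⊆ future :=
    (inter_subset_left).trans (stripE_subset_future (by linarith))
  refine hw.mixedNorm_gradAbs_le_of_shell (measurableSet_regHalfE τ) hEf (L := R / 32) hτ hR0
    (by positivity) (by positivity) (by positivity) (by linarith) ?_ ?_ ?_ ?_ ?_
  · rw [mul_pow, sq_rpow_neg_half hτ.le, sq_rpow_neg_three_half hR0.le]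
    field_simp
  · rw [mul_pow, mul_pow, sq_rpow_neg_half hτ.le, sq_rpow_neg_half hR0.le,
      sq_rpow_neg_three_half hR0.le]
    field_simp
  · rintro ⟨t, x⟩ ⟨⟨_, h1, h2⟩, h3, h4⟩
    simp only at h1 h2 h3 h4 ⊢
    constructor <;> linarith
  · rintro ⟨t, x⟩ ⟨⟨⟨h5, h6⟩, h1, h2⟩, h3, h4⟩ σ ⟨hσ0, hσ1⟩ ρ ⟨hρ0, hρ1⟩ x' hx'
    simp only at h1 h2 h3 h4 h5 h6 hx' ⊢
    refine ⟨⟨⟨?_, ?_⟩, ?_, ?_⟩, ?_, ?_⟩ <;> simp only [hx'] <;> nlinarith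
  · rintro p hp hp0
    have ⟨⟨_, h1, h2⟩, h3, h4⟩ := hp
    have hp1 : 0 < p.1 := hEf hp
    -- Here `t - r ≥ (7/16)τ` is multiplied by `t + r ≥ t`; all of `t`, `r`, `t - r` are comparable
    -- to `τ`.
    have h5 : 7 / 16 * τ * p.1 ≤ p.1 ^ 2 - ‖p.2‖ ^ 2 := by
      nlinarith [mul_nonneg (by linarith : 0 ≤ p.1 - ‖p.2‖ - 7 / 16 * τ) hp1.le,
        mul_nonneg (by linarith : 0 ≤ p.1 - ‖p.2‖) (norm_nonneg p.2)]
    have h6 : R / 32 * p.1 ^ 2 ≤ 17 / 512 * τ ^ 2 * p.1 := by nlinarith [mul_pos hτ hp1]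
    have h7 : 0 < τ ^ 2 * p.1 := by positivity
    refine hw.hessBound_of_timelike (hEf hp) (by positivity) hR0.le hp0 ?_ ?_ ?_ ?_
    · linarith
    · linarith
    · refine le_trans ?_ (mul_le_mul h4 h5 (by positivity) (norm_nonneg _))
      linarith
    · refine le_trans ?_ (mul_le_mul_of_nonneg_left h5 hR0.le)
      rw [hRτ] at h6 ⊢
      linarith

theorem Smooth.estimate_regU (hw : Smooth w) {τ U : ℝ} (hU : 1 ≤ U) (hUτ : U ≤ τ / 4) :
    mixedNorm ⊤ ⊤ (regU τ U) (gradAbs w) ≤ mainConst *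
      (ENNReal.ofReal (U ^ (-(1 / 2) : ℝ) * τ ^ (-(3 / 2) : ℝ)) *
          mixedNorm 2 2 (regUE τ U) (gradZ 3 w) +
        ENNReal.ofReal (U ^ (-(1 / 2) : ℝ) * τ ^ (-(1 / 2) : ℝ)) *
          mixedNorm 2 2 (regUE τ U) (boxZ 2 w)) := by
  have hτ : 0 < τ := by linarith
  have hU0 : 0 < U := by linarith
  have hEf := (regUE_subset_stripE τ U).trans (stripE_subset_future (by linarith))
  -- Spheres have radius of order `τ`, but radial segments may only be as long as the distance `U`
  -- to the cone.
  refine hw.mixedNorm_gradAbs_le_of_shell (measurableSet_regUE τ U) hEf (L := U / 32) (κ := τ) hτ hτ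
    (by positivity) (by positivity) (by positivity) (by linarith) ?_ ?_ ?_ ?_ ?_
  · rw [mul_pow, sq_rpow_neg_half hU0.le, sq_rpow_neg_three_half hτ.le]
    field_simp
  · rw [mul_pow, mul_pow, sq_rpow_neg_half hU0.le, sq_rpow_neg_half hτ.le,
      sq_rpow_neg_three_half hτ.le]
    field_simp
  · rintro ⟨t, x⟩ hp
    rw [regU] at hp
    split_ifs at hp with h
    · obtain ⟨⟨_, h1, h2⟩, h3⟩ := hp
      simp only [mem_ofPred_eq, abs_le] at h1 h2 h3 ⊢
      constructor <;> linarith [h3.2]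
    · obtain ⟨⟨_, h1, h2⟩, h3, h4⟩ := hp
      simp only at h1 h2 h3 h4 ⊢
      constructor <;> linarith
  · rintro ⟨t, x⟩ hp σ ⟨hσ0, hσ1⟩ ρ ⟨hρ0, hρ1⟩ x' hx'
    rw [regU] at hp
    rw [regUE]
    split_ifs at hp ⊢ with h
    · obtain ⟨⟨⟨h5, h6⟩, h1, h2⟩, h3⟩ := hp
      simp only [mem_ofPred_eq, abs_le] at h1 h2 h3 h5 h6 hx'
      refine ⟨⟨⟨?_, ?_⟩, ?_, ?_⟩, ?_⟩
      all_goals simp only [mem_ofPred_eq, abs_le, hx']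
      · nlinarith
      · nlinarith
      · nlinarith
      · nlinarith
      · constructor <;> nlinarith [h3.1, h3.2]
    · obtain ⟨⟨⟨h5, h6⟩, h1, h2⟩, h3, h4⟩ := hp
      simp only at h1 h2 h3 h4 h5 h6 hx' ⊢
      refine ⟨⟨⟨?_, ?_⟩, ?_, ?_⟩, ?_, ?_⟩ <;> simp only [hx'] <;> nlinarith
  · intro p hp hp0
    by_cases h : U = 1
    -- For `U = 1` the region meets the light cone and nothing can be divided by `t² - r²`; the
    -- segment length 1/32 makes that unnecessary.
    · refine hw.hessBound_of_le_one (hEf hp) (by rw [h]; norm_num) hτ.le ?_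
      rw [norm_smul, norm_inv, norm_norm, inv_mul_cancel₀ (norm_ne_zero_iff.2 hp0)]
    · have hp' := hp
      rw [regUE, if_neg h] at hp'
      have ⟨⟨_, h1, h2⟩, h3, h4⟩ := hp'
      have hp1 : 0 < p.1 := hEf hp
      -- Since `t ≥ (7/8)τ` and `t - r ≤ (17/8)(τ/4)`, the difference is 28/32 - 17/32.
      have hr : 11 / 32 * τ ≤ ‖p.2‖ := by linarith
      have h5 : 7 / 8 * U * p.1 ≤ p.1 ^ 2 - ‖p.2‖ ^ 2 := by
        nlinarith [mul_nonneg (by linarith : 0 ≤ p.1 - ‖p.2‖ - 7 / 8 * U) hp1.le,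
          mul_nonneg (by linarith : 0 ≤ p.1 - ‖p.2‖) (norm_nonneg p.2)]
      have h6 : U / 32 * p.1 ^ 2 ≤ 17 / 256 * (τ * U * p.1) := by nlinarith [mul_pos hU0 hp1]
      have h7 : 0 < τ * U * p.1 := by positivity
      refine hw.hessBound_of_timelike (hEf hp) (by positivity) hτ.le hp0 ?_ ?_ ?_ ?_
      · linarith
      · linarith
      · refine le_trans ?_ (mul_le_mul hr h5 (by positivity) (norm_nonneg _))
        linarith
      · refine le_trans ?_ (mul_le_mul_of_nonneg_left h5 hτ.le)
        linarith

end Regions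

end WaveDecay

end

theorem mainTheorem3 :
    ∃ K : ℝ≥0, ∀ w : WaveDecay.SpaceTime → ℝ,
      ContDiffOn ℝ ∞ w {p : WaveDecay.SpaceTime | 0 < p.1} →
      (∀ τ R : ℝ, 1 ≤ τ → 1 ≤ R → R ≤ τ / 2 → (R = 1 ∨ R ≤ τ / 4) →
        WaveDecay.mixedNorm ∞ ∞ (WaveDecay.regR τ R) (WaveDecay.gradAbs w) ≤
          K * (ENNReal.ofReal (τ ^ (-(1 / 2) : ℝ) * R ^ (-(3 / 2) : ℝ)) *
                WaveDecay.mixedNorm 2 2 (WaveDecay.regRE τ R) (WaveDecay.gradZ 3 w) +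
              ENNReal.ofReal (τ ^ (-(1 / 2) : ℝ) * R ^ (-(1 / 2) : ℝ)) *
                WaveDecay.mixedNorm 2 2 (WaveDecay.regRE τ R) (WaveDecay.boxZ 2 w))) ∧
      (∀ τ R : ℝ, 1 ≤ τ → 1 ≤ R → R = τ / 2 →
        WaveDecay.mixedNorm ∞ ∞ (WaveDecay.regHalf τ) (WaveDecay.gradAbs w) ≤
          K * (ENNReal.ofReal (τ ^ (-(1 / 2) : ℝ) * R ^ (-(3 / 2) : ℝ)) *
                WaveDecay.mixedNorm 2 2 (WaveDecay.regHalfE τ) (WaveDecay.gradZ 3 w) +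
              ENNReal.ofReal (τ ^ (-(1 / 2) : ℝ) * R ^ (-(1 / 2) : ℝ)) *
                WaveDecay.mixedNorm 2 2 (WaveDecay.regHalfE τ) (WaveDecay.boxZ 2 w))) ∧
      (∀ τ U : ℝ, 1 ≤ τ → 1 ≤ U → U ≤ τ / 4 →
        WaveDecay.mixedNorm ∞ ∞ (WaveDecay.regU τ U) (WaveDecay.gradAbs w) ≤
          K * (ENNReal.ofReal (U ^ (-(1 / 2) : ℝ) * τ ^ (-(3 / 2) : ℝ)) *
                WaveDecay.mixedNorm 2 2 (WaveDecay.regUE τ U) (WaveDecay.gradZ 3 w) +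
              ENNReal.ofReal (U ^ (-(1 / 2) : ℝ) * τ ^ (-(1 / 2) : ℝ)) *
                WaveDecay.mixedNorm 2 2 (WaveDecay.regUE τ U) (WaveDecay.boxZ 2 w))) := by
  refine ⟨WaveDecay.mainConst, fun w hw => ⟨fun τ R _ hR hRτ h => ?_, fun τ R _ hR hRτ => ?_,
    fun τ U _ hU hUτ => ?_⟩⟩
  · rcases hR.eq_or_lt with rfl | hR1
    · exact WaveDecay.Smooth.estimate_regR_one hw (by linarith)
    · exact WaveDecay.Smooth.estimate_regR hw hR1 (h.resolve_left hR1.ne')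
  · exact WaveDecay.Smooth.estimate_regHalf hw hR hRτ
  · exact WaveDecay.Smooth.estimate_regU hw hU hUτ
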